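/- A $(2n+1)$-round public-coin interactive proof (PCIP) $\Pi$ for a language $\mathcal L$ with finite challenge space $\mathcal C$ is a protocol in which, on an instance $x$, the prover sends $a_1$, the verifier replies with a uniformly random $c_1\in\mathcal C$, …, the prover sends $a_n$, the verifier replies with a uniformly random $c_n\in\mathcal C$, the prover sends $z$, and the verifier accepts iff $V(x,a_1,c_1,\dots,a_n,c_n,z)=1$; an honest prover is accepted with certainty on every $x\in\mathcal L$. Its soundness error is the supremum, over all $x\notin\mathcal L$ and all (unbounded) provers, of the acceptance probability. In the Fiat–Shamir transform $\mathsf{FS}[\Pi]$ a proof $(a_1,\dots,a_n,z)$ for $x$ is accepted with respect to a hash function $H$ iff $V(x,a_1,c_1,\dots,a_n,c_n,z)=1$ for $c_1=H(0,x,a_1)$ and $c_i=H(i-1,c_{i-1},a_i)$, $2\le i\le n$. A $q$-query dishonest prover is a quantum algorithm that makes $q$ (controlled) queries $|b\rangle|u\rangle|y\rangle\mapsto|b\rangle|u\rangle|y\oplus b\cdot H(u)\rangle$ to $H$ and outputs some $x$ and $(a_1,\dots,a_n,z)$; its success probability is the probability, over a uniformly random $H$ and its measurement, that $x\notin\mathcal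 L$ and the proof is accepted for $x$. **Theorem.** For every integer $n\ge 1$ and every $Q\in\mathbb N$ there exists a $(2n+1)$-round PCIP $\Pi$, with challenge space $\mathcal C=\{0,1\}^\ell$ for some $\ell$ and soundness error $\epsilon>0$ such that $|\mathcal C|\ge 1/\epsilon$, and such that for every $q\le Q$ there exists a $q$-query dishonest prover against $\mathsf{FS}[\Pi]$ with success probability at least $n^{-2n}q^{2n}\epsilon$. -/

import Mathlib

/-! ### Public-coin interactive proof systems -/

/-- A (computationally unbounded) prover in a `(2n+1)`-round public-coin protocol with messages
in `A`, challenges in `C` and final response in `Z`, described by its input/output behaviour: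
the law of the next message given the transcript of all previous rounds, and the law of the final
response given the whole transcript.  Only `msg k` with `k < n` is used.  Keeping an internal
(classical or quantum) state does not give more behaviours: the law of each message conditioned
on the classical transcript so far is again of this form. -/
structure Prover (n : ℕ) (A C Z : Type) where
  /-- The message of round `k` (counted from `0`), given the transcript `(a, c)` so far. -/
  msg : (k : ℕ) → (Fin k → A × C) → PMF A
  /-- The final response. -/
  resp : (Fin n → A × C) → PMF Z

namespace Prover

variable {n : ℕ} {A C Z : Type} [Fintype C] [Nonempty C]

/-- The law of the transcript of the first `k` rounds: in every round the prover sends a message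
and the verifier answers with a fresh uniformly random challenge. -/
noncomputable def transcript (P : Prover n A C Z) : (k : ℕ) → PMF (Fin k → A × C)
  | 0 => PMF.pure Fin.elim0
  | k + 1 =>
    (P.transcript k).bind fun t =>
      (P.msg k t).bind fun a =>
        (PMF.uniformOfFintype C).bind fun c =>
          PMF.pure (Fin.snoc (α := fun _ => A × C) t (a, c))

/-- The law of the full transcript `(a₁, c₁, …, aₙ, cₙ, z)` of the interaction. -/
noncomputable def run (P : Prover n A C Z) : PMF ((Fin n → A × C) × Z) :=
  (P.transcript n).bind fun t => (P.resp t).bind fun z => PMF.pure (t, z)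

/-- The probability that the transcript satisfies the predicate `V`. -/
noncomputable def acceptProb (P : Prover n A C Z)
    (V : (Fin n → A) → (Fin n → C) → Z → Prop) : ℝ :=
  (P.run.toOuterMeasure
    {s | V (fun i => (s.1 i).1) (fun i => (s.1 i).2) s.2}).toReal

end Prover

/-- A `(2n+1)`-round public-coin interactive proof system, with instances in `X`, prover messages
in `A`, challenge space `C` and final responses in `Z`: a language, the predicate `V` by which the
verifier decides on the transcript, and an honest prover that is accepted with certainty on every
instance of the language. -/
structure PCIP (n : ℕ) (X A C Z : Type) [Fintype C] [Nonempty C] where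
  /-- The language. -/
  lang : Set X
  /-- The verification predicate `V(x, a₁, c₁, …, aₙ, cₙ, z)`. -/
  accepts : X → (Fin n → A) → (Fin n → C) → Z → Prop
  /-- The honest prover. -/
  prover : X → Prover n A C Z
  /-- Perfect completeness. -/
  complete : ∀ x ∈ lang, (prover x).acceptProb (accepts x) = 1

/-- `ε` is the soundness error of `Pi`: the supremum, over all no-instances and all dishonest
provers, of the probability that the verifier accepts. -/
def PCIP.IsSoundnessError {n : ℕ} {X A C Z : Type} [Fintype C] [Nonempty C]
    (Pi : PCIP n X A C Z) (ε : ℝ) : Prop :=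
  IsLUB {p : ℝ | ∃ x, x ∉ Pi.lang ∧ ∃ P : Prover n A C Z, p = P.acceptProb (Pi.accepts x)} ε

/-! ### The multi-round Fiat-Shamir transformation -/

/-- Inputs of the hash function: a round index (counted from `0`), the instance or the previous
challenge, and the current message. -/
abbrev HashInput (n : ℕ) (X A C : Type) : Type := Fin n × (X ⊕ C) × A

/-- The hash chain `c₁ = H(0, x, a₁)`, `cᵢ = H(i-1, cᵢ₋₁, aᵢ)`, with rounds counted from `0`. -/
def hashChain {n : ℕ} {X A C : Type} (H : HashInput n X A C → C) (x : X) (a : Fin n → A) :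
    (i : ℕ) → i < n → C
  | 0, h => H (⟨0, h⟩, Sum.inl x, a ⟨0, h⟩)
  | i + 1, h =>
    H (⟨i + 1, h⟩, Sum.inr (hashChain H x a i (Nat.lt_of_succ_lt h)), a ⟨i + 1, h⟩)

/-- The Fiat-Shamir verifier: accept the proof `(a₁, …, aₙ, z)` for the instance `x` iff `V` holds
with the challenges computed by the hash chain. -/
def PCIP.fsAccepts {n : ℕ} {X A C Z : Type} [Fintype C] [Nonempty C] (Pi : PCIP n X A C Z)
    (H : HashInput n X A C → C) (x : X) (a : Fin n → A) (z : Z) : Prop :=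
  Pi.accepts x a (fun i => hashChain H x a i.1 i.2) z

/-! ### Quantum oracle algorithms -/

/-- The action of the controlled oracle on basis states:
`|b⟩|x⟩|y⟩|w⟩ ↦ |b⟩|x⟩|y + b · H(x)⟩|w⟩`. -/
def oraclePerm {D C : Type} [AddGroup C] (W : Type) (H : D → C) :
    Equiv.Perm (Bool × D × C × W) where
  toFun s := (s.1, s.2.1, s.2.2.1 + (if s.1 then H s.2.1 else 0), s.2.2.2)
  invFun s := (s.1, s.2.1, s.2.2.1 - (if s.1 then H s.2.1 else 0), s.2.2.2)
  left_inv s := by simp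
  right_inv s := by simp

/-- A quantum oracle algorithm making `q` (controlled) queries to a function `H : D → C`, with a
classical output in `Out`: an initial state, the unitaries that follow the queries, and the map
that reads the output off the result of measuring all registers in the computational basis at
the end. -/
structure OracleAlgorithm (q : ℕ) (D C Out : Type) [Fintype D] [Fintype C] where
  /-- Labels of the basis states of the work register. -/
  Work : Type
  /-- The work register is finite-dimensional. -/
  fintypeWork : Fintype Work
  /-- The initial state. -/
  init : EuclideanSpace ℂ (Bool × D × C × Work)
  /-- The initial state is a unit vector. -/
  norm_init : ‖init‖ = 1
  /-- The unitary that follows the `i`-th query. -/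
  unitary : Fin q →
    EuclideanSpace ℂ (Bool × D × C × Work) ≃ₗᵢ[ℂ] EuclideanSpace ℂ (Bool × D × C × Work)
  /-- The output, as a function of the measurement result. -/
  output : Bool × D × C × Work → Out

attribute [instance] OracleAlgorithm.fintypeWork

namespace OracleAlgorithm

variable {q : ℕ} {D C Out : Type} [Fintype D] [Fintype C] [AddGroup C]

/-- The oracle unitary. -/
noncomputable def query (𝒜 : OracleAlgorithm q D C Out) (H : D → C) :
    EuclideanSpace ℂ (Bool × D × C × 𝒜.Work) ≃ₗᵢ[ℂ]
      EuclideanSpace ℂ (Bool × D × C × 𝒜.Work) :=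
  LinearIsometryEquiv.piLpCongrLeft 2 ℂ ℂ (oraclePerm 𝒜.Work H)

/-- The final state `A_q O^H ⋯ A_1 O^H |φ₀⟩`. -/
noncomputable def finalState (𝒜 : OracleAlgorithm q D C Out) (H : D → C) :
    EuclideanSpace ℂ (Bool × D × C × 𝒜.Work) :=
  Fin.foldl q (fun φ i => 𝒜.unitary i (𝒜.query H φ)) 𝒜.init

open Classical in
/-- The probability that the output of the algorithm run with oracle `H` satisfies `G`. -/
noncomputable def prob (𝒜 : OracleAlgorithm q D C Out) (H : D → C) (G : Out → Prop) : ℝ :=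
  ∑ s, if G (𝒜.output s) then ‖𝒜.finalState H s‖ ^ 2 else 0

end OracleAlgorithm

/-- A `q`-query dishonest prover against the Fiat-Shamir transformation of a PCIP: it outputs an
instance `x` and a proof `(a₁, …, aₙ, z)`. -/
abbrev FSAdversary (q n : ℕ) (X A C Z : Type) [Fintype X] [Fintype A] [Fintype C] :=
  OracleAlgorithm q (HashInput n X A C) C (X × (Fin n → A) × Z)

open Classical in
/-- The success probability of a dishonest prover, over a uniformly random function `H` and its
own measurement: it has to output a no-instance together with an accepted proof for it. -/
noncomputable def PCIP.fsSuccess {q n : ℕ} {X A C Z : Type} [Fintype X] [Fintype A] [Fintype C]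
    [Nonempty C] [AddGroup C] (Pi : PCIP n X A C Z) (𝒜 : FSAdversary q n X A C Z) : ℝ :=
  (∑ H : HashInput n X A C → C,
      𝒜.prob H fun o => o.1 ∉ Pi.lang ∧ Pi.fsAccepts H o.1 o.2.1 o.2.2) /
    (Fintype.card (HashInput n X A C → C) : ℝ)

/-- Bit strings of length `ℓ`; addition is bitwise exclusive or. -/
abbrev BitString (ℓ : ℕ) : Type := Fin ℓ → ZMod 2

/-! The protocol is trivial: a proof for the no-instance `false` is accepted iff every challenge
lies in a subgroup `S` of density `p = 2⁻ᵐ`, whatever the messages are. Each challenge is fresh and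
uniform in the interaction, so every prover succeeds with probability exactly `p ^ n = ε`.

Against the hash function one can search, round by round, for a message whose challenge lies in `S`.
For small `p` a search with `s - 1` queries succeeds with probability more than `11/10 * s² * p`;
one further query reads the challenge found and enters the next round. Rounds that are not attacked
are guessed, at probability `p` each. A list `L` of such `s` thus costs `L.sum - 1` queries and
gains the factor `∏ 11/10 * s²` over `ε`. It remains to choose `L` with product at least `(q / n) ^
(2 * n)`; the factor `11/10` pays for rounding `q / n` to integers (`exists_schedule`).

The constant `11/10` comes from a variant of Grover search that spends one query per iteration. A
response register in the uniform superposition of `S` is unchanged by a query at a good message and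
moved to an orthogonal coset at a bad one, and the next query moves it back, so nothing has to be
uncomputed. The initial split between the two values of the control bit is a free parameter
(`reachable_search`, `searchCoef_zero`, `exists_searchCoef_gt`).

Unitaries are never written down: only the Gram matrix of the states over all oracles matters. The
rounds combine on average because the hash inputs of different rounds are disjoint, hence
independent (`le_avg_search_bind`, `exists_attack`). -/

/-! ### Algorithms up to unitaries: Gram matrices. -/

/-- Two finite families of vectors with the same Gram matrix are related by a unitary. -/
theorem exists_linearIsometryEquiv_of_inner_eq {ι E : Type*} [Fintype ι]
    [NormedAddCommGroup E] [InnerProductSpace ℂ E] [FiniteDimensional ℂ E] (u v : ι → E)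
    (h : ∀ i j, inner ℂ (u i) (u j) = inner ℂ (v i) (v j)) :
    ∃ U : E ≃ₗᵢ[ℂ] E, ∀ i, U (u i) = v i := by
  classical
  let f : (ι → ℂ) →ₗ[ℂ] E := Fintype.linearCombination ℂ u
  let g : (ι → ℂ) →ₗ[ℂ] E := Fintype.linearCombination ℂ v
  -- Equality of these norms makes `f c ↦ g c` a well-defined isometry on the range of `f`, which
  -- extends to the whole space in finite dimension.
  have hn : ∀ c, ‖f c‖ = ‖g c‖ := by
    intro c
    have : inner ℂ (f c) (f c) = inner ℂ (g c) (g c) := by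
      simp only [f, g, Fintype.linearCombination_apply, sum_inner, inner_sum, inner_smul_left,
        inner_smul_right, h]
    rw [inner_self_eq_norm_sq_to_K, inner_self_eq_norm_sq_to_K] at this
    have h2 : ‖f c‖ ^ 2 = ‖g c‖ ^ 2 := by exact_mod_cast this
    exact (sq_eq_sq₀ (norm_nonneg _) (norm_nonneg _)).1 h2
  have hk : ∀ c, f c = 0 → g c = 0 := fun c hc => by
    rw [← norm_eq_zero, ← hn, hc, norm_zero]
  obtain ⟨s, hs⟩ := f.rangeRestrict.exists_rightInverse_of_surjective f.range_rangeRestrict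
  have hfs : ∀ w : LinearMap.range f, f (s w) = w := fun w =>
    congrArg Subtype.val (LinearMap.congr_fun hs w)
  let L : LinearMap.range f →ₗᵢ[ℂ] E :=
    { toLinearMap := g ∘ₗ s
      norm_map' := fun w => by
        change ‖g (s w)‖ = ‖w‖
        rw [← hn, hfs]; rfl }
  refine ⟨L.extend.toLinearIsometryEquiv rfl, fun i => ?_⟩
  have hu : f (Pi.single i 1) = u i := by simp [f, Fintype.linearCombination_apply, Pi.single_apply]
  have hv : g (Pi.single i 1) = v i := by simp [g, Fintype.linearCombination_apply, Pi.single_apply]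
  have hmem : u i ∈ LinearMap.range f := ⟨_, hu⟩
  have h1 := L.extend_apply ⟨u i, hmem⟩
  rw [LinearIsometry.coe_toLinearIsometryEquiv, h1, ← hv]
  change g (s ⟨u i, hmem⟩) = _
  rw [← sub_eq_zero, ← map_sub]
  apply hk
  rw [map_sub, hfs, hu, sub_self]

section Reachable

variable {D C W : Type} [AddGroup C]

/-- The oracle unitary acting on real amplitude functions. -/
def queryState (H : D → C) (ψ : Bool × D × C × W → ℝ) : Bool × D × C × W → ℝ :=
  fun s => ψ ((oraclePerm W H).symm s)

theorem queryState_apply (H : D → C) (ψ : Bool × D × C × W → ℝ) (b : Bool) (d : D) (y : C)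
    (w : W) : queryState H ψ (b, d, y, w) = ψ (b, d, y - (if b then H d else 0), w) := rfl

variable [Fintype D] [Fintype C] [Fintype W]

/-- The families of (real) states, indexed by the oracle, that can be prepared with `q` queries.
Between two queries an algorithm may pass to any family with the same Gram matrix. -/
def Reachable : (q : ℕ) → ((D → C) → Bool × D × C × W → ℝ) → Prop
  | 0, ψ => ∃ v : Bool × D × C × W → ℝ, ∑ s, v s ^ 2 = 1 ∧ ∀ H, ψ H = v
  | q + 1, ψ => ∃ φ : (D → C) → Bool × D × C × W → ℝ, Reachable q φ ∧
      ∀ H H', ∑ s, ψ H s * ψ H' s = ∑ s, queryState H (φ H) s * queryState H' (φ H') s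

/-- A real amplitude function as a vector of the Hilbert space. -/
noncomputable def toVec {T : Type} (v : T → ℝ) : EuclideanSpace ℂ T :=
  WithLp.toLp 2 fun s => (v s : ℂ)

theorem inner_toVec {T : Type} [Fintype T] (v w : T → ℝ) :
    inner ℂ (toVec v) (toVec w) = ((∑ s, v s * w s : ℝ) : ℂ) := by
  simp [toVec, PiLp.inner_apply, mul_comm]

theorem norm_toVec {T : Type} [Fintype T] (v : T → ℝ) (h : ∑ s, v s ^ 2 = 1) :
    ‖toVec v‖ = 1 := by
  rw [EuclideanSpace.norm_eq]
  simp [toVec, h]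

theorem Reachable.exists_fold {q : ℕ} {ψ : (D → C) → Bool × D × C × W → ℝ}
    (h : Reachable q ψ) :
    ∃ (v : EuclideanSpace ℂ (Bool × D × C × W)) (U : Fin q →
      EuclideanSpace ℂ (Bool × D × C × W) ≃ₗᵢ[ℂ] EuclideanSpace ℂ (Bool × D × C × W)),
      ‖v‖ = 1 ∧ ∀ H, Fin.foldl q (fun φ i => U i
        (LinearIsometryEquiv.piLpCongrLeft 2 ℂ ℂ (oraclePerm W H) φ)) v = toVec (ψ H) := by
  classical
  induction q generalizing ψ with
  | zero =>
    obtain ⟨v, hv, hψ⟩ := h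
    exact ⟨toVec v, Fin.elim0, norm_toVec v hv, fun H => by simp [hψ H]⟩
  | succ q ih =>
    obtain ⟨φ, hφ, hg⟩ := h
    obtain ⟨v, U, hv, hU⟩ := ih hφ
    obtain ⟨V, hV⟩ := exists_linearIsometryEquiv_of_inner_eq
      (fun H : D → C => toVec (queryState H (φ H))) (fun H => toVec (ψ H))
      (fun H H' => by rw [inner_toVec, inner_toVec, hg])
    refine ⟨v, Fin.snoc (α := fun _ => _) U V, hv, fun H => ?_⟩
    rw [Fin.foldl_succ_last]
    simp only [Fin.snoc_castSucc, Fin.snoc_last, hU H]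
    rw [← hV H]
    congr 1

/-- Every reachable family is the family of final states of an oracle algorithm. -/
theorem Reachable.exists_algorithm {q : ℕ} {ψ : (D → C) → Bool × D × C × W → ℝ}
    (h : Reachable q ψ) {Out : Type} (out : Bool × D × C × W → Out) :
    ∃ 𝒜 : OracleAlgorithm q D C Out, ∀ (H : D → C) (G : Out → Prop) [DecidablePred G],
      𝒜.prob H G = ∑ s, if G (out s) then ψ H s ^ 2 else 0 := by
  obtain ⟨v, U, hv, hU⟩ := h.exists_fold
  refine ⟨⟨W, inferInstance, v, hv, U, out⟩, fun H G _ => ?_⟩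
  unfold OracleAlgorithm.prob OracleAlgorithm.finalState OracleAlgorithm.query
  simp only [hU H]
  refine Finset.sum_congr rfl fun s _ => ?_
  split_ifs <;> simp [toVec]

end Reachable

/-! ### Sequential composition with deferred measurement. -/

section Composition

variable {D C : Type}

/-- Enlarging the work register along a map of labels. -/
noncomputable def extendState {W V : Type} (j : W → V) (ψ : Bool × D × C × W → ℝ) :
    Bool × D × C × V → ℝ :=
  Function.extend (fun s : Bool × D × C × W => (s.1, s.2.1, s.2.2.1, j s.2.2.2)) ψ 0

theorem injective_mapWork {W V : Type} {j : W → V} (hj : Function.Injective j) :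
    Function.Injective (fun s : Bool × D × C × W => (s.1, s.2.1, s.2.2.1, j s.2.2.2)) := by
  rintro ⟨b, d, y, w⟩ ⟨b', d', y', w'⟩ h
  simp only [Prod.mk.injEq] at h ⊢
  exact ⟨h.1, h.2.1, h.2.2.1, hj h.2.2.2⟩

theorem extendState_apply {W V : Type} {j : W → V} (hj : Function.Injective j)
    (ψ : Bool × D × C × W → ℝ) (b : Bool) (d : D) (y : C) (w : W) :
    extendState j ψ (b, d, y, j w) = ψ (b, d, y, w) :=
  (injective_mapWork hj).extend_apply ψ 0 (b, d, y, w)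

theorem extendState_of_notMem {W V : Type} {j : W → V} (ψ : Bool × D × C × W → ℝ)
    (b : Bool) (d : D) (y : C) {v : V} (hv : v ∉ Set.range j) :
    extendState j ψ (b, d, y, v) = 0 := by
  refine Function.extend_apply' _ _ _ ?_
  rintro ⟨⟨b', d', y', w⟩, h⟩
  simp only [Prod.mk.injEq] at h
  exact hv ⟨w, h.2.2.2⟩

/-- The state of a run that measured `t` with amplitude `α t` and continued with `χ t`. -/
def bindState {T V W : Type} (α : T → ℝ) (χ : T → Bool × D × C × V → ℝ) :
    Bool × D × C × (W ⊕ (T × V)) → ℝ :=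
  fun s => Sum.elim (fun _ => 0)
    (fun tv => α tv.1 * χ tv.1 (s.1, s.2.1, s.2.2.1, tv.2)) s.2.2.2

theorem queryState_bindState [AddGroup C] {T V W : Type} (H : D → C) (α : T → ℝ)
    (χ : T → Bool × D × C × V → ℝ) :
    queryState H (bindState (W := W) α χ) = bindState α fun t => queryState H (χ t) := by
  funext ⟨b, d, y, w⟩
  cases w <;> rfl

variable [Fintype D] [Fintype C]

theorem sum_extendState {W V : Type} [Fintype W] [Fintype V] {j : W → V}
    (hj : Function.Injective j) (f : Bool × D × C × W → ℝ) (g : Bool × D × C × V → ℝ)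
    (h0 : ∀ b d y v, v ∉ Set.range j → g (b, d, y, v) = 0)
    (h1 : ∀ b d y w, g (b, d, y, j w) = f (b, d, y, w)) :
    ∑ s, g s = ∑ s, f s := by
  refine (Fintype.sum_of_injective _ (injective_mapWork hj) f g ?_ ?_).symm
  · rintro ⟨b, d, y, v⟩ hs
    refine h0 _ _ _ _ ?_
    rintro ⟨w, rfl⟩
    exact hs ⟨(b, d, y, w), rfl⟩
  · rintro ⟨b, d, y, w⟩
    exact (h1 b d y w).symm

theorem sum_bind {T V W : Type} [Fintype T] [Fintype V] [Fintype W]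
    (g : Bool × D × C × (W ⊕ (T × V)) → ℝ) (f : T → Bool × D × C × V → ℝ)
    (h0 : ∀ b d y w, g (b, d, y, Sum.inl w) = 0)
    (h1 : ∀ b d y t v, g (b, d, y, Sum.inr (t, v)) = f t (b, d, y, v)) :
    ∑ s, g s = ∑ t, ∑ s, f t s := by
  simp only [Fintype.sum_prod_type, Fintype.sum_sum_type, h0, h1, Finset.sum_const_zero, zero_add]
  symm
  refine Finset.sum_comm.trans (Finset.sum_congr rfl fun b _ => ?_)
  refine Finset.sum_comm.trans (Finset.sum_congr rfl fun d _ => ?_)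
  exact Finset.sum_comm.trans (Finset.sum_congr rfl fun y _ => rfl)

variable [AddGroup C]

theorem Reachable.extend {W V : Type} [Fintype W] [Fintype V] {j : W → V}
    (hj : Function.Injective j) {q : ℕ} {ψ : (D → C) → Bool × D × C × W → ℝ}
    (h : Reachable q ψ) : Reachable q fun H => extendState j (ψ H) := by
  induction q generalizing ψ with
  | zero =>
    obtain ⟨v, hv, hψ⟩ := h
    refine ⟨extendState j v, ?_, fun H => by simp only [hψ H]⟩
    rw [← hv]
    refine sum_extendState hj _ _ (fun b d y v hv => ?_) (fun b d y w => ?_)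
    · rw [extendState_of_notMem _ _ _ _ hv]; simp
    · rw [extendState_apply hj]
  | succ q ih =>
    obtain ⟨φ, hφ, hg⟩ := h
    refine ⟨_, ih hφ, fun H H' => ?_⟩
    rw [sum_extendState hj (fun s => ψ H s * ψ H' s), hg]
    · refine (sum_extendState hj _ _ (fun b d y v hv => ?_) (fun b d y w => ?_)).symm
      · simp only [queryState_apply, extendState_of_notMem _ _ _ _ hv, mul_zero]
      · simp only [queryState_apply, extendState_apply hj]
    · intro b d y v hv
      simp only [extendState_of_notMem _ _ _ _ hv, mul_zero]
    · intro b d y w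
      simp only [extendState_apply hj]

/-- For `q > 0` this is built into the definition. With no queries, all inner products equal `1`,
which forces the unit vectors of the family to coincide. -/
theorem Reachable.of_gram_eq {W : Type} [Fintype W] {q : ℕ}
    {ψ χ : (D → C) → Bool × D × C × W → ℝ} (h : Reachable q ψ)
    (hg : ∀ H H', ∑ s, χ H s * χ H' s = ∑ s, ψ H s * ψ H' s) : Reachable q χ := by
  cases q with
  | zero =>
    obtain ⟨v, hv, hψ⟩ := h
    have h1 : ∀ H H', ∑ s, χ H s * χ H' s = 1 := fun H H' => by
      rw [hg, hψ, hψ, ← hv]; exact Finset.sum_congr rfl fun s _ => (sq _).symm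
    -- The zero oracle is an arbitrary representative.
    refine ⟨χ 0, by simpa [sq] using h1 0 0, fun H => ?_⟩
    have h2 : ∑ s, (χ H s - χ 0 s) ^ 2 = 0 := by
      have : ∀ s, (χ H s - χ 0 s) ^ 2
          = χ H s * χ H s - 2 * (χ H s * χ 0 s) + χ 0 s * χ 0 s := fun s => by ring
      simp only [this, Finset.sum_add_distrib, Finset.sum_sub_distrib, ← Finset.mul_sum, h1]
      norm_num
    rw [Finset.sum_eq_zero_iff_of_nonneg fun _ _ => sq_nonneg _] at h2
    funext s
    have := h2 s (Finset.mem_univ s)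
    linarith [pow_eq_zero_iff (two_ne_zero) |>.1 this]
  | succ q =>
    obtain ⟨φ, hφ, hφg⟩ := h
    exact ⟨φ, hφ, fun H H' => by rw [hg, hφg]⟩

theorem sum_queryState_sq {W : Type} [Fintype W] (H : D → C) (ψ : Bool × D × C × W → ℝ) :
    ∑ s, queryState H ψ s * queryState H ψ s = ∑ s, ψ s * ψ s :=
  (oraclePerm W H).symm.sum_comp fun s => ψ s * ψ s

theorem Reachable.sum_sq {W : Type} [Fintype W] {q : ℕ}
    {ψ : (D → C) → Bool × D × C × W → ℝ} (h : Reachable q ψ) (H : D → C) :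
    ∑ s, ψ H s * ψ H s = 1 := by
  induction q generalizing ψ with
  | zero =>
    obtain ⟨v, hv, hψ⟩ := h
    rw [hψ, ← hv]; exact Finset.sum_congr rfl fun s _ => (sq _).symm
  | succ q ih =>
    obtain ⟨φ, hφ, hg⟩ := h
    rw [hg, sum_queryState_sq, ih hφ]

/-- Copying the basis label `t` into the work register makes the branches orthogonal, so the Gram
matrix is the sum over `t` of the products of the two stages' entries. When `r = 0` the second stage
is a fixed unit vector and does not change the Gram matrix. The summand `W` of the work register
hosts the first stage. -/
theorem Reachable.bind {W V : Type} [Fintype W] [Fintype V] {q r : ℕ}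
    {ψ : (D → C) → Bool × D × C × W → ℝ} (h : Reachable q ψ)
    {χ : Bool × D × C × W → (D → C) → Bool × D × C × V → ℝ} (hχ : ∀ t, Reachable r (χ t)) :
    Reachable (q + r) fun H => bindState (W := W) (ψ H) fun t => χ t H := by
  have key : ∀ (α α' : Bool × D × C × W → ℝ) (χ χ' : Bool × D × C × W → Bool × D × C × V → ℝ),
      ∑ s, bindState (W := W) α χ s * bindState (W := W) α' χ' s
        = ∑ t, α t * α' t * ∑ s, χ t s * χ' t s := fun α α' χ χ' => by
    rw [sum_bind _ (fun t s => α t * α' t * (χ t s * χ' t s))]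
    · simp only [Finset.mul_sum]
    · intros; simp [bindState]
    · intros; simp only [bindState, Sum.elim_inr]; ring
  induction r generalizing χ with
  | zero =>
    choose v hv hχ using hχ
    refine (h.extend (Sum.inl_injective (β := (Bool × D × C × W) × V))).of_gram_eq fun H H' => ?_
    rw [key, sum_extendState Sum.inl_injective (fun s => ψ H s * ψ H' s)]
    · refine Finset.sum_congr rfl fun t _ => ?_
      rw [hχ t H, hχ t H']
      simp only [← sq, hv, mul_one]
    · intro b d y w hw
      simp only [extendState_of_notMem _ _ _ _ hw, mul_zero]
    · intro b d y w
      simp only [extendState_apply Sum.inl_injective]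
  | succ r ih =>
    choose φ hφ hg using hχ
    refine ⟨_, ih hφ, fun H H' => ?_⟩
    simp only [queryState_bindState, key, hg]

open Classical in
/-- `q` queries suffice to sample from a law that dominates `μ H`, for every oracle `H`. -/
def Samples (q : ℕ) {O : Type} (μ : (D → C) → O → ℝ) : Prop :=
  ∃ (W : Type) (_ : Fintype W) (ψ : (D → C) → Bool × D × C × W → ℝ)
    (out : Bool × D × C × W → O), Reachable q ψ ∧
      ∀ H o, μ H o ≤ ∑ s, if out s = o then ψ H s * ψ H s else 0

open Classical in
/-- `q` queries suffice to produce an output with the property `G H` with probability at least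
`v H`, for every oracle `H`. -/
def Achieves (q : ℕ) {O : Type} (G : (D → C) → O → Prop) (v : (D → C) → ℝ) : Prop :=
  ∃ (W : Type) (_ : Fintype W) (ψ : (D → C) → Bool × D × C × W → ℝ)
    (out : Bool × D × C × W → O), Reachable q ψ ∧
      ∀ H, v H ≤ ∑ s, if G H (out s) then ψ H s * ψ H s else 0

-- The continuation may depend on the sampled value. Lower bounds on the sampling law suffice
-- because all contributions are nonnegative.
open Classical in
theorem Samples.bind {q r : ℕ} {O P R : Type} [Fintype O] [Nonempty R]
    {μ : (D → C) → O → ℝ} (hμ : Samples q μ) (hμ0 : ∀ H o, 0 ≤ μ H o) (F : O → P → R)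
    {G : (D → C) → R → Prop} {v : O → (D → C) → ℝ}
    (hv : ∀ o, Achieves r (fun H b => G H (F o b)) (v o)) :
    Achieves (q + r) G fun H => ∑ o, μ H o * v o H := by
  obtain ⟨W, _, ψ, out, hψ, hμψ⟩ := hμ
  choose V instV χ out' hχ hvχ using hv
  have hinj : ∀ o, Function.Injective (Sigma.mk (β := V) o) := fun o => sigma_mk_injective
  -- The continuations have different work registers, hence the sigma type. The branch `Sum.inl`
  -- carries no amplitude, so its output is arbitrary.
  refine ⟨W ⊕ ((Bool × D × C × W) × Σ o, V o), inferInstance, _,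
    fun s => Sum.elim (fun _ => Classical.arbitrary R)
      (fun tv => F tv.2.1 (out' tv.2.1 (s.1, s.2.1, s.2.2.1, tv.2.2))) s.2.2.2,
    hψ.bind fun t => (hχ (out t)).extend (hinj (out t)), fun H => ?_⟩
  rw [sum_bind _ (fun t s => ψ H t * ψ H t *
    if G H (F s.2.2.2.1 (out' s.2.2.2.1 (s.1, s.2.1, s.2.2.1, s.2.2.2.2))) then
      extendState (Sigma.mk (out t)) (χ (out t) H) s
        * extendState (Sigma.mk (out t)) (χ (out t) H) s else 0)]
  rotate_left
  · intros; simp [bindState]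
  · intros
    simp only [bindState, Sum.elim_inr, mul_ite, mul_zero]
    congr 1
    ring
  have hsum : ∀ t, (∑ s, ψ H t * ψ H t *
      if G H (F s.2.2.2.1 (out' s.2.2.2.1 (s.1, s.2.1, s.2.2.1, s.2.2.2.2))) then
        extendState (Sigma.mk (out t)) (χ (out t) H) s
          * extendState (Sigma.mk (out t)) (χ (out t) H) s else 0)
      = ∑ o, (if out t = o then ψ H t * ψ H t else 0) *
        ∑ s, if G H (F o (out' o s)) then χ o H s * χ o H s else 0 := fun t => by
    rw [← Finset.mul_sum]
    simp only [ite_mul, zero_mul, Finset.sum_ite_eq, Finset.mem_univ, if_true]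
    congr 1
    refine sum_extendState (hinj (out t)) _ _ ?_ ?_
    · intro b d y w hw
      simp only [extendState_of_notMem _ _ _ _ hw, mul_zero, ite_self]
    · intro b d y w
      simp only [extendState_apply (hinj (out t))]
  simp only [hsum]
  rw [Finset.sum_comm]
  refine Finset.sum_le_sum fun o _ => ?_
  rw [← Finset.sum_mul]
  have hP : 0 ≤ ∑ s, if G H (F o (out' o s)) then χ o H s * χ o H s else 0 :=
    Finset.sum_nonneg fun s _ => by split_ifs <;> [exact mul_self_nonneg _; exact le_rfl]
  exact (mul_le_mul_of_nonneg_left (hvχ o H) (hμ0 H o)).trans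
    (mul_le_mul_of_nonneg_right (hμψ H o) hP)

/-- The first alternative serves conditioning: where the claimed bound is not positive, the two
goals need not be related. -/
theorem Achieves.mono {q : ℕ} {O : Type} {G G' : (D → C) → O → Prop} {v v' : (D → C) → ℝ}
    (h : Achieves q G v) (hv : ∀ H, v' H ≤ 0 ∨ v' H ≤ v H ∧ ∀ o, G H o → G' H o) :
    Achieves q G' v' := by
  classical
  obtain ⟨W, _, ψ, out, hψ, hvψ⟩ := h
  refine ⟨W, inferInstance, ψ, out, hψ, fun H => ?_⟩
  rcases hv H with hv | ⟨hv, hG⟩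
  · exact hv.trans (Finset.sum_nonneg fun s _ => by
      split_ifs <;> [exact mul_self_nonneg _; exact le_rfl])
  · refine (hv.trans (hvψ H)).trans (Finset.sum_le_sum fun s _ => ?_)
    split_ifs with h1 h2
    · exact le_rfl
    · exact absurd (hG _ h1) h2
    · exact mul_self_nonneg _
    · exact le_rfl

/-- The basis state at `d₀`, `0` with the control bit `b`. -/
noncomputable def basisState (b : Bool) (d₀ : D) (y₀ : C) : Bool × D × C × Unit → ℝ := by
  classical exact fun s => if s = (b, d₀, y₀, ()) then 1 else 0

theorem exists_reachable [Nonempty D] (q : ℕ) :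
    ∃ ψ : (D → C) → Bool × D × C × Unit → ℝ, Reachable q ψ := by
  induction q with
  | zero =>
    refine ⟨fun _ => basisState false (Classical.arbitrary D) 0, _, ?_, fun _ => rfl⟩
    simp [basisState]
  | succ q ih =>
    obtain ⟨ψ, hψ⟩ := ih
    exact ⟨fun H => queryState H (ψ H), ψ, hψ, fun _ _ => rfl⟩

theorem Achieves.const [Nonempty D] (q : ℕ) {O : Type} (G : (D → C) → O → Prop) (o : O) :
    Achieves q G fun H => by classical exact if G H o then 1 else 0 := by
  classical
  obtain ⟨ψ, hψ⟩ := exists_reachable (D := D) (C := C) q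
  refine ⟨Unit, inferInstance, ψ, fun _ => o, hψ, fun H => ?_⟩
  beta_reduce
  split_ifs with h
  · simp [hψ.sum_sq]
  · simp

theorem Achieves.add_queries [Nonempty D] {q : ℕ} (r : ℕ) {O : Type} [Nonempty O]
    {G : (D → C) → O → Prop} {v : (D → C) → ℝ} (h : Achieves q G v) :
    Achieves (r + q) G v := by
  classical
  obtain ⟨ψ, hψ⟩ := exists_reachable (D := D) (C := C) r
  have h1 : Samples r (fun (_ : D → C) (_ : Unit) => (1 : ℝ)) :=
    ⟨Unit, inferInstance, ψ, fun _ => (), hψ, fun H _ => by simp [hψ.sum_sq]⟩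
  simpa using h1.bind (fun _ _ => zero_le_one) (fun _ o => o) (v := fun _ => v) fun _ => h

open Classical in
/-- One query learns the value of the oracle at a point. -/
theorem samples_oracle_value (d : D) :
    Samples 1 fun (H : D → C) (c : C) => if H d = c then (1 : ℝ) else 0 := by
  refine ⟨Unit, inferInstance, fun H => queryState H (basisState true d 0), fun s => s.2.2.1,
    ⟨fun _ => basisState true d 0, ⟨_, by simp [basisState], fun _ => rfl⟩, fun _ _ => rfl⟩,
    fun H c => ?_⟩
  have h1 : ∑ s, queryState H (basisState (C := C) true d 0) s
      * queryState H (basisState true d 0) s = 1 := by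
    rw [sum_queryState_sq]; simp [basisState]
  beta_reduce
  split_ifs with h
  · rw [← h1]
    refine Finset.sum_le_sum fun ⟨b, d', y, w⟩ _ => ?_
    split_ifs with h2
    · exact le_rfl
    · refine le_of_eq ?_
      have : queryState H (basisState true d 0) (b, d', y, w) = 0 := by
        rw [queryState_apply, basisState, if_neg]
        simp only [Prod.mk.injEq, not_and]
        rintro rfl rfl h3
        exact absurd ((sub_eq_zero.1 h3).trans h) h2
      rw [this, zero_mul]
  · exact Finset.sum_nonneg fun s _ => by split_ifs <;> [exact mul_self_nonneg _; exact le_rfl]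

end Composition

/-! ### Quantum search with one query per iteration. -/

section Search

variable {J P A C : Type} [AddCommGroup C]

open Classical in
/-- The indicator function of a subgroup. -/
noncomputable def indic (S : AddSubgroup C) (y : C) : ℝ := if y ∈ S then 1 else 0

theorem indic_mul_self (S : AddSubgroup C) (y : C) : indic S y * indic S y = indic S y := by
  unfold indic; split_ifs <;> simp

theorem indic_sub_of_mem {S : AddSubgroup C} {h : C} (hh : h ∈ S) (y : C) :
    indic S (y - h) = indic S y := by
  have : y - h ∈ S ↔ y ∈ S := by rw [sub_eq_add_neg]; exact S.add_mem_cancel_right (S.neg_mem hh)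
  by_cases hy : y ∈ S
  · rw [indic, indic, if_pos hy, if_pos (this.2 hy)]
  · rw [indic, indic, if_neg hy, if_neg (mt this.1 hy)]

theorem indic_mul_indic_sub {S : AddSubgroup C} {h : C} (hh : h ∉ S) (y : C) :
    indic S y * indic S (y - h) = 0 := by
  unfold indic
  split_ifs with h1 h2
  · exact absurd (by simpa using S.sub_mem h1 h2) hh
  all_goals simp

theorem sum_indic [Fintype C] (S : AddSubgroup C) : ∑ y, indic S y = (Nat.card S : ℝ) := by
  classical
  simp [indic, Nat.card_eq_fintype_card, Fintype.card_subtype]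

open Classical in
/-- The states occurring in the search for a good message `a`, i.e. one with `h a ∈ S`, at the
oracle inputs `(j, p, a)`: with control bit `1` the response register holds the uniform
superposition of `S` (amplitude `f₀ a`) or of `h a + S` (amplitude `f₁ a`); the amplitude `e` sits
at control bit `0`. -/
noncomputable def searchState (j : J) (p : P) (S : AddSubgroup C) (K : ℝ) (h : A → C)
    (f₀ f₁ : A → ℝ) (e : ℝ) : Bool × (J × P × A) × C × Unit → ℝ :=
  fun s => if s.2.1.1 = j ∧ s.2.1.2.1 = p then
    K * (if s.1 then f₀ s.2.1.2.2 * indic S s.2.2.1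
      + f₁ s.2.1.2.2 * indic S (s.2.2.1 - h s.2.1.2.2) else e * indic S s.2.2.1) else 0

-- Translation by `h ∈ S` fixes `S`. For `h ∉ S` it exchanges `S` and `h + S`, because `h + h = 0`;
-- so a query swaps the clean and filled amplitudes of bad messages only.
open Classical in
theorem queryState_searchState (hC : ∀ c : C, c + c = 0) (j : J) (p : P) (S : AddSubgroup C)
    (K : ℝ) (H : J × P × A → C) (f₀ f₁ : A → ℝ) (e : ℝ)
    (hf : ∀ a, H (j, p, a) ∈ S → f₁ a = 0) :
    queryState H (searchState j p S K (fun a => H (j, p, a)) f₀ f₁ e)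
      = searchState j p S K (fun a => H (j, p, a))
        (fun a => if H (j, p, a) ∈ S then f₀ a else f₁ a)
        (fun a => if H (j, p, a) ∈ S then 0 else f₀ a) e := by
  funext ⟨b, ⟨j', p', a⟩, y, w⟩
  rw [queryState_apply]
  unfold searchState
  dsimp only
  by_cases hjp : j' = j ∧ p' = p
  · rw [if_pos hjp, if_pos hjp]
    obtain ⟨rfl, rfl⟩ := hjp
    cases b with
    | false => simp
    | true =>
      simp only [if_true]
      have h2 : y - H (j', p', a) - H (j', p', a) = y := by rw [sub_sub, hC, sub_zero]
      rw [h2]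
      split_ifs with h
      · rw [indic_sub_of_mem h, hf a h]
      · ring
  · rw [if_neg hjp, if_neg hjp]

variable [Fintype A]

open Classical in
/-- The fraction of good messages. -/
noncomputable def goodFraction (S : AddSubgroup C) (h : A → C) : ℝ :=
  (∑ a, if h a ∈ S then (1 : ℝ) else 0) / Fintype.card A

open Classical in
theorem sum_ite_goodFraction [Nonempty A] (S : AddSubgroup C) (h : A → C) (u v : ℝ) :
    ∑ a, (if h a ∈ S then u else v)
      = Fintype.card A * (goodFraction S h * u + (1 - goodFraction S h) * v) := by
  have hN : (Fintype.card A : ℝ) ≠ 0 := by simp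
  have h1 : ∀ a, (if h a ∈ S then u else v) = (if h a ∈ S then (1 : ℝ) else 0) * (u - v) + v := by
    intro a; split_ifs <;> ring
  simp only [h1, Finset.sum_add_distrib, ← Finset.sum_mul, Finset.sum_const, Finset.card_univ,
    nsmul_eq_mul, goodFraction]
  field_simp
  ring

variable [Fintype J] [Fintype P] [Fintype C]

/-- Clean and filled parts are orthogonal, even for different oracles, since a coset `h + S` with `h
∉ S` is disjoint from `S`. The overlap of the filled parts is left unevaluated: the unitaries of the
search do not touch them. -/
theorem sum_searchState_mul (j : J) (p : P) (S : AddSubgroup C) (K : ℝ) (h h' : A → C)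
    (f₀ f₁ f₀' f₁' : A → ℝ) (e e' : ℝ) (hf : ∀ a, h a ∈ S → f₁ a = 0)
    (hf' : ∀ a, h' a ∈ S → f₁' a = 0) :
    ∑ s, searchState j p S K h f₀ f₁ e s * searchState j p S K h' f₀' f₁' e' s
      = K ^ 2 * (Nat.card S * (∑ a, f₀ a * f₀' a + Fintype.card A * (e * e'))
        + ∑ a, f₁ a * f₁' a * ∑ y, indic S (y - h a) * indic S (y - h' a)) := by
  classical
  have h1 : ∀ a y, (f₀ a * indic S y + f₁ a * indic S (y - h a))
      * (f₀' a * indic S y + f₁' a * indic S (y - h' a))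
      = f₀ a * f₀' a * indic S y
        + f₁ a * f₁' a * (indic S (y - h a) * indic S (y - h' a)) := by
    intro a y
    have e1 : f₁ a * (indic S y * indic S (y - h a)) = 0 := by
      by_cases ha : h a ∈ S
      · rw [hf a ha, zero_mul]
      · rw [indic_mul_indic_sub ha, mul_zero]
    have e2 : f₁' a * (indic S y * indic S (y - h' a)) = 0 := by
      by_cases ha : h' a ∈ S
      · rw [hf' a ha, zero_mul]
      · rw [indic_mul_indic_sub ha, mul_zero]
    linear_combination f₀ a * f₀' a * indic_mul_self S y + f₀' a * e1 + f₀ a * e2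
  have h2 : ∀ y, e * indic S y * (e' * indic S y) = e * e' * indic S y := fun y => by
    linear_combination e * e' * indic_mul_self S y
  have h3 : ∀ (b : Bool) (j' : J) (p' : P) (a : A) (y : C) (w : Unit),
      searchState j p S K h f₀ f₁ e (b, (j', p', a), y, w)
        * searchState j p S K h' f₀' f₁' e' (b, (j', p', a), y, w)
      = if j' = j then if p' = p then K ^ 2 * (if b then f₀ a * f₀' a * indic S y
        + f₁ a * f₁' a * (indic S (y - h a) * indic S (y - h' a)) else e * e' * indic S y)
        else 0 else 0 := by
    intro b j' p' a y w
    unfold searchState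
    dsimp only
    by_cases hj : j' = j
    · by_cases hp : p' = p
      · cases b
        · simp only [hj, hp, and_self, if_true]
          rw [← h2]; simp only [Bool.false_eq_true, if_false]; ring
        · simp only [hj, hp, and_self, if_true]
          rw [← h1]; ring
      · simp [hj, hp]
    · simp [hj]
  simp only [Fintype.sum_prod_type, h3, Fintype.sum_bool, Finset.univ_unique,
    Finset.sum_singleton, if_true, Bool.false_eq_true, if_false]
  simp only [Finset.sum_ite_irrel, Finset.sum_const_zero, Finset.sum_ite_eq', Finset.mem_univ,
    if_true, ← Finset.mul_sum, Finset.sum_add_distrib, sum_indic, ← Finset.sum_mul,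
    Finset.sum_const, Finset.card_univ, nsmul_eq_mul]
  ring

/-- The amplitudes of the search after `t + 1` queries when a fraction `p` of the messages is good:
the amplitude of good messages, that of bad ones with a clean response register, and that of bad
ones with a filled response register. -/
noncomputable def searchCoef (x y p : ℝ) : ℕ → ℝ × ℝ × ℝ
  | 0 => (x - y + p * y, x + p * y, y)
  | t + 1 =>
    let c := searchCoef x y p t
    let m := p * c.1 + (1 - p) * c.2.2
    (2 * m - c.1, 2 * m - c.2.2, c.2.1)

-- After the first query, the unitary swaps the control-bit-`0` state with the uniform clean state
-- and negates the clean states orthogonal to the latter. After each later query it reflects the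
-- clean amplitudes about their mean, as in Grover search.
open Classical in
theorem reachable_search [Nonempty A] (hC : ∀ c : C, c + c = 0) (j : J) (p : P)
    (S : AddSubgroup C) {K : ℝ} (hK : K ^ 2 * (Nat.card S * Fintype.card A) = 1) {x y : ℝ}
    (hxy : x ^ 2 + y ^ 2 = 1) (t : ℕ) :
    Reachable (t + 1) fun H : J × P × A → C =>
      let c := searchCoef x y (goodFraction S fun a => H (j, p, a)) t
      searchState j p S K (fun a => H (j, p, a))
        (fun a => if H (j, p, a) ∈ S then c.1 else c.2.1)
        (fun a => if H (j, p, a) ∈ S then 0 else c.2.2)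
        (goodFraction S (fun a => H (j, p, a)) * y) := by
  have hsum : ∀ (a b : ℝ) (f g : A → ℝ), ∑ i, (a - f i) * (b - g i)
      = Fintype.card A * (a * b) - a * ∑ i, g i - b * ∑ i, f i + ∑ i, f i * g i := by
    intro a b f g
    have : ∀ i, (a - f i) * (b - g i) = a * b - a * g i - b * f i + f i * g i :=
      fun i => by ring
    simp only [this, Finset.sum_add_distrib, Finset.sum_sub_distrib, ← Finset.mul_sum,
      Finset.sum_const, Finset.card_univ, nsmul_eq_mul]
    ring
  have key : ∀ (h h' : A → C) (a b u v u' v' : ℝ),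
      ∑ i, (if h i ∈ S then a - u else a - v) * (if h' i ∈ S then b - u' else b - v')
      = Fintype.card A * (a * b)
        - a * (Fintype.card A * (goodFraction S h' * u' + (1 - goodFraction S h') * v'))
        - b * (Fintype.card A * (goodFraction S h * u + (1 - goodFraction S h) * v))
        + ∑ i, (if h i ∈ S then u else v) * (if h' i ∈ S then u' else v') := by
    intro h h' a b u v u' v'
    rw [← sum_ite_goodFraction, ← sum_ite_goodFraction, ← hsum]
    refine Finset.sum_congr rfl fun i _ => ?_
    split_ifs <;> rfl
  induction t with
  | zero =>
    have hq : ∀ H : J × P × A → C,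
        queryState H (searchState j p S K (fun _ => 0) (fun _ => y) (fun _ => 0) x)
        = searchState j p S K (fun a => H (j, p, a)) (fun a => if H (j, p, a) ∈ S then y else 0)
          (fun a => if H (j, p, a) ∈ S then 0 else y) x := by
      intro H
      rw [← queryState_searchState hC j p S K H (fun _ => y) (fun _ => 0) x fun _ _ => rfl]
      congr 1
      unfold searchState; simp
    refine ⟨fun _ => searchState j p S K (fun _ => 0) (fun _ => y) (fun _ => 0) x,
      ⟨_, ?_, fun _ => rfl⟩, fun H H' => ?_⟩
    · simp only [sq (searchState _ _ _ _ _ _ _ _ _)]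
      rw [sum_searchState_mul _ _ _ _ _ _ _ _ _ _ _ _ (fun _ _ => rfl) (fun _ _ => rfl)]
      simp only [Finset.sum_const, Finset.card_univ, nsmul_eq_mul, mul_zero, zero_mul, add_zero]
      linear_combination hK + K ^ 2 * (Nat.card S * Fintype.card A) * hxy
    · simp only [hq, searchCoef]
      rw [sum_searchState_mul _ _ _ _ _ _ _ _ _ _ _ _ (fun _ h => if_pos h) fun _ h => if_pos h,
        sum_searchState_mul _ _ _ _ _ _ _ _ _ _ _ _ (fun _ h => if_pos h) fun _ h => if_pos h]
      congr 3
      have := key (fun a => H (j, p, a)) (fun a => H' (j, p, a))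
        (x + (goodFraction S fun a => H (j, p, a)) * y)
        (x + (goodFraction S fun a => H' (j, p, a)) * y) y 0 y 0
      simp only [sub_zero] at this
      simp only [sub_add_eq_add_sub]
      rw [this]
      ring
  | succ t ih =>
    refine ⟨_, ih, fun H H' => ?_⟩
    simp only [searchCoef]
    rw [queryState_searchState hC j p S K H _ _ _ fun _ h => if_pos h,
      queryState_searchState hC j p S K H' _ _ _ fun _ h => if_pos h]
    generalize searchCoef x y (goodFraction S fun a => H (j, p, a)) t = c
    generalize searchCoef x y (goodFraction S fun a => H' (j, p, a)) t = c'
    have hh : ∀ (h : A → C) (u v w : ℝ), (fun a => if h a ∈ S then (if h a ∈ S then u else v)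
        else (if h a ∈ S then 0 else w)) = fun a => if h a ∈ S then u else w := by
      intro h u v w; funext a; split_ifs <;> rfl
    have hh' : ∀ (h : A → C) (u v : ℝ), (fun a => if h a ∈ S then 0
        else (if h a ∈ S then u else v)) = fun a => if h a ∈ S then 0 else v := by
      intro h u v; funext a; split_ifs <;> rfl
    rw [hh (fun a => H (j, p, a)), hh (fun a => H' (j, p, a)), hh' (fun a => H (j, p, a)),
      hh' (fun a => H' (j, p, a))]
    rw [sum_searchState_mul _ _ _ _ _ _ _ _ _ _ _ _ (fun _ h => if_pos h) fun _ h => if_pos h,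
      sum_searchState_mul _ _ _ _ _ _ _ _ _ _ _ _ (fun _ h => if_pos h) fun _ h => if_pos h]
    congr 3
    -- With `a = 2m` and `b = 2m'`, for the means `m`, `m'` of the clean amplitudes, the first three
    -- terms of `key` cancel.
    rw [key (fun a => H (j, p, a)) (fun a => H' (j, p, a))]
    ring

open Classical in
/-- The law of the message found by the search with `t + 1` queries. -/
theorem samples_search [Nonempty A] (hC : ∀ c : C, c + c = 0) (j : J) (p : P)
    (S : AddSubgroup C) {x y : ℝ} (hxy : x ^ 2 + y ^ 2 = 1) (t : ℕ) :
    Samples (t + 1) fun (H : J × P × A → C) (a : A) =>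
      if H (j, p, a) ∈ S then
        (searchCoef x y (goodFraction S fun a => H (j, p, a)) t).1 ^ 2 / Fintype.card A
      else 0 := by
  have hN : 0 < (Fintype.card A : ℝ) := by exact_mod_cast Fintype.card_pos
  have hS : 0 < (Nat.card S : ℝ) := by exact_mod_cast Nat.card_pos
  obtain ⟨K, hK⟩ : ∃ K : ℝ, K ^ 2 * (Nat.card S * Fintype.card A) = 1 :=
    ⟨√((Nat.card S * Fintype.card A)⁻¹), by
      rw [Real.sq_sqrt (by positivity), inv_mul_cancel₀ (by positivity)]⟩
  refine ⟨Unit, inferInstance, _, fun s => s.2.1.2.2, reachable_search hC j p S hK hxy t,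
    fun H a => ?_⟩
  dsimp only
  generalize searchCoef x y (goodFraction S fun a => H (j, p, a)) t = c
  split_ifs with h
  · have hinj : Function.Injective fun y : C => ((true, (j, p, a), y, ()) :
        Bool × (J × P × A) × C × Unit) := by
      intro y y' h; simpa using h
    refine le_trans (le_of_eq ?_) (Finset.sum_le_sum_of_subset_of_nonneg
      (Finset.subset_univ (Finset.univ.map ⟨_, hinj⟩)) fun s _ _ => ?_)
    · rw [Finset.sum_map]
      have : ∀ y : C, K * (c.1 * indic S y + 0 * indic S (y - H (j, p, a)))
          * (K * (c.1 * indic S y + 0 * indic S (y - H (j, p, a))))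
          = K ^ 2 * c.1 ^ 2 * indic S y := fun y => by
        linear_combination K ^ 2 * c.1 ^ 2 * indic_mul_self S y
      simp only [Function.Embedding.coeFn_mk, searchState, if_true, and_self, if_pos h, this,
        ← Finset.mul_sum, sum_indic]
      field_simp
      linear_combination -c.1 ^ 2 * hK
    · split_ifs <;> [exact mul_self_nonneg _; exact le_rfl]
  · exact Finset.sum_nonneg fun s _ => by split_ifs <;> [exact mul_self_nonneg _; exact le_rfl]

end Search

theorem goodFraction_nonneg {A C : Type} [Fintype A] [AddCommGroup C] (S : AddSubgroup C) (h : A → C) :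
    0 ≤ goodFraction S h := by
  unfold goodFraction
  exact div_nonneg (Finset.sum_nonneg fun _ _ => by split_ifs <;> norm_num) (Nat.cast_nonneg _)

/-! ### Moments of the fraction of good messages under a random oracle. -/

section Average

variable {D C : Type} [Fintype D] [Fintype C]

open Classical in
/-- The average over a uniformly random oracle. -/
noncomputable def avg (f : (D → C) → ℝ) : ℝ := (∑ H, f H) / Fintype.card (D → C)

theorem avg_mono {f g : (D → C) → ℝ} (h : ∀ H, f H ≤ g H) : avg f ≤ avg g :=
  div_le_div_of_nonneg_right (Finset.sum_le_sum fun H _ => h H) (Nat.cast_nonneg _)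

theorem avg_mul_left (c : ℝ) (f : (D → C) → ℝ) : avg (fun H => c * f H) = c * avg f := by
  simp only [avg, ← Finset.mul_sum, mul_div_assoc]

theorem avg_mul_right (c : ℝ) (f : (D → C) → ℝ) : avg (fun H => f H * c) = avg f * c := by
  simp only [mul_comm _ c, avg_mul_left]

theorem avg_sub (f g : (D → C) → ℝ) : avg (fun H => f H - g H) = avg f - avg g := by
  simp only [avg, Finset.sum_sub_distrib, sub_div]

theorem avg_sum {ι : Type*} (s : Finset ι) (f : ι → (D → C) → ℝ) :
    avg (fun H => ∑ i ∈ s, f i H) = ∑ i ∈ s, avg (f i) := by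
  simp only [avg, Finset.sum_div]
  exact Finset.sum_comm

theorem avg_const [Nonempty C] (c : ℝ) : avg (fun _ : D → C => c) = c := by
  classical
  have : (Fintype.card (D → C) : ℝ) ≠ 0 := by exact_mod_cast Fintype.card_ne_zero
  simp only [avg, Finset.sum_const, Finset.card_univ, nsmul_eq_mul]
  field_simp

/-- The values of a random oracle on a set of inputs and on its complement are independent. -/
theorem avg_eq_avg_avg [Nonempty C] (P : D → Prop) (Φ : (D → C) → (D → C) → ℝ)
    (hΦ : ∀ H K H' K', (∀ d, P d → H d = K d) → (∀ d, ¬ P d → H' d = K' d) →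
      Φ H H' = Φ K K') :
    avg (fun H => Φ H H) = avg fun H => avg fun H' => Φ H H' := by
  classical
  -- Exchanging the values of two oracles outside `P` permutes the pairs of oracles and turns the
  -- joint average into the diagonal one.
  let mix : (D → C) → (D → C) → D → C := fun H H' d => if P d then H d else H' d
  have hmix : Function.Involutive fun x : (D → C) × (D → C) => (mix x.1 x.2, mix x.2 x.1) := by
    rintro ⟨H, H'⟩
    simp only [mix, Prod.mk.injEq]
    constructor <;> funext d <;> split_ifs <;> rfl
  have h1 : ∑ x : (D → C) × (D → C), Φ x.1 x.2 = ∑ x : (D → C) × (D → C), Φ x.1 x.1 := by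
    rw [← Equiv.sum_comp hmix.toPerm fun x : (D → C) × (D → C) => Φ x.1 x.1]
    refine Finset.sum_congr rfl fun x _ => hΦ _ _ _ _ (fun d hd => ?_) fun d hd => ?_
    · simp [Function.Involutive.toPerm, mix, hd]
    · simp [Function.Involutive.toPerm, mix, hd]
  have hc : (Fintype.card (D → C) : ℝ) ≠ 0 := by exact_mod_cast Fintype.card_ne_zero
  simp only [Fintype.sum_prod_type, Finset.sum_const, Finset.card_univ, nsmul_eq_mul] at h1
  rw [← Finset.mul_sum] at h1
  simp only [avg, ← Finset.sum_div]
  rw [h1]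
  field_simp

variable [AddCommGroup C]

-- Shifting the oracle by a constant `c` permutes the oracles; summing over all `c` counts `S` once
-- for each oracle.
open Classical in
theorem avg_mem (S : AddSubgroup C) (d : D) :
    avg (fun H : D → C => if H d ∈ S then (1 : ℝ) else 0) = (Nat.card S : ℝ) / Nat.card C := by
  have hc : (Fintype.card (D → C) : ℝ) ≠ 0 := by exact_mod_cast Fintype.card_ne_zero
  have hC : (Fintype.card C : ℝ) ≠ 0 := by exact_mod_cast Fintype.card_ne_zero
  have h1 : ∀ c : C, ∑ H : D → C, (if H d ∈ S then (1 : ℝ) else 0)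
      = ∑ H : D → C, if H d + c ∈ S then (1 : ℝ) else 0 := fun c =>
    (Equiv.sum_comp (Equiv.addRight (fun _ : D => c)) fun H : D → C =>
      if H d ∈ S then (1 : ℝ) else 0).symm
  have h2 : ∀ H : D → C, ∑ c, (if H d + c ∈ S then (1 : ℝ) else 0) = Nat.card S := fun H => by
    exact (Equiv.sum_comp (Equiv.addLeft (H d)) fun c => if c ∈ S then (1 : ℝ) else 0).trans
      (sum_indic S)
  have h3 : (Fintype.card C : ℝ) * ∑ H : D → C, (if H d ∈ S then (1 : ℝ) else 0)
      = Fintype.card (D → C) * Nat.card S := by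
    rw [← nsmul_eq_mul, ← Finset.card_univ, ← Finset.sum_const, Finset.sum_congr rfl fun c _ => h1 c,
      Finset.sum_comm]
    simp only [h2, Finset.sum_const, Finset.card_univ, nsmul_eq_mul]
  rw [avg, Nat.card_eq_fintype_card (α := C), div_eq_div_iff hc hC]
  linarith

open Classical in
theorem avg_mem_mul_mem (S : AddSubgroup C) {d d' : D} (hd : d ≠ d') :
    avg (fun H : D → C => (if H d ∈ S then (1 : ℝ) else 0) * if H d' ∈ S then 1 else 0)
      = ((Nat.card S : ℝ) / Nat.card C) ^ 2 := by
  rw [avg_eq_avg_avg (· = d) (fun H H' => (if H d ∈ S then (1 : ℝ) else 0) *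
    if H' d' ∈ S then 1 else 0)]
  · simp only [avg_mul_left, avg_mul_right, avg_mem, sq]
  · intro H K H' K' h1 h2
    rw [h1 d rfl, h2 d' hd.symm]

theorem avg_goodFraction {A : Type} [Fintype A] [Nonempty A] (S : AddSubgroup C) (i : A → D) :
    avg (fun H : D → C => goodFraction S fun a => H (i a)) = (Nat.card S : ℝ) / Nat.card C := by
  classical
  have hN : (Fintype.card A : ℝ) ≠ 0 := by exact_mod_cast Fintype.card_ne_zero
  simp only [goodFraction, div_eq_mul_inv (∑ _, _), avg_mul_right, avg_sum, avg_mem,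
    Finset.sum_const, Finset.card_univ, nsmul_eq_mul]
  field_simp

/-- Values at distinct inputs are independent, and the diagonal pairs contribute the second term. -/
theorem avg_goodFraction_sq_le {A : Type} [Fintype A] [Nonempty A] (S : AddSubgroup C)
    {i : A → D} (hi : Function.Injective i) :
    avg (fun H : D → C => (goodFraction S fun a => H (i a)) ^ 2)
      ≤ ((Nat.card S : ℝ) / Nat.card C) ^ 2
        + ((Nat.card S : ℝ) / Nat.card C) / Fintype.card A := by
  classical
  have hN : 0 < (Fintype.card A : ℝ) := by exact_mod_cast Fintype.card_pos
  set p := (Nat.card S : ℝ) / Nat.card C with hp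
  have hp0 : 0 ≤ p := by positivity
  have h1 : ∀ H : D → C, (goodFraction S fun a => H (i a)) ^ 2
      = (∑ a, ∑ b, (if H (i a) ∈ S then (1 : ℝ) else 0) * if H (i b) ∈ S then 1 else 0)
        * ((Fintype.card A : ℝ)⁻¹) ^ 2 := fun H => by
    rw [← Finset.sum_mul_sum, goodFraction]; ring
  have h2 : ∀ a b, avg (fun H : D → C => (if H (i a) ∈ S then (1 : ℝ) else 0) *
      if H (i b) ∈ S then 1 else 0) ≤ p ^ 2 + if a = b then p else 0 := by
    intro a b
    split_ifs with h
    · subst h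
      have : ∀ H : D → C, ((if H (i a) ∈ S then (1 : ℝ) else 0) * if H (i a) ∈ S then 1 else 0)
          = if H (i a) ∈ S then 1 else 0 := fun H => by split_ifs <;> simp
      simp only [this, avg_mem]
      linarith [sq_nonneg p]
    · rw [avg_mem_mul_mem S (hi.ne h), add_zero]
  simp only [h1, avg_mul_right, avg_sum]
  calc _ ≤ (∑ a : A, ∑ b : A, (p ^ 2 + if a = b then p else 0)) * ((Fintype.card A : ℝ)⁻¹) ^ 2 := by
        gcongr with a _ b _
        exact h2 a b
    _ = p ^ 2 + p / Fintype.card A := by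
        simp only [Finset.sum_add_distrib, Finset.sum_const, Finset.sum_ite_eq, Finset.mem_univ,
          if_true, Finset.card_univ, nsmul_eq_mul]
        field_simp

end Average

/-! ### Success of the search at small density. -/

theorem continuous_searchCoef (x y : ℝ) (t : ℕ) : Continuous fun p => searchCoef x y p t := by
  induction t with
  | zero => simp only [searchCoef]; fun_prop
  | succ t ih =>
    simp only [searchCoef]
    fun_prop

/-- For a small density of good challenges, the search with `t + 1` queries succeeds with
probability close to the density times the squared limit amplitude. -/
theorem exists_density_bound {x y w : ℝ} {t : ℕ} (hw0 : 0 ≤ w)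
    (hw : w < (searchCoef x y 0 t).1 ^ 2) :
    ∃ p₀ : ℝ, 0 < p₀ ∧ ∀ (D C A : Type) [Fintype D] [Fintype C] [AddCommGroup C] [Fintype A]
      [Nonempty A] (S : AddSubgroup C) (i : A → D), Function.Injective i →
      ((Nat.card S : ℝ) / Nat.card C) ≤ p₀ →
      1 / (Fintype.card A : ℝ) ≤ (Nat.card S : ℝ) / Nat.card C →
      w * ((Nat.card S : ℝ) / Nat.card C) ≤ avg fun H : D → C =>
        (searchCoef x y (goodFraction S fun a => H (i a)) t).1 ^ 2
          * goodFraction S fun a => H (i a) := by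
  obtain ⟨w', hw', hw'2⟩ := exists_between hw
  have hc : Continuous fun p => (searchCoef x y p t).1 ^ 2 :=
    (continuous_fst.comp (continuous_searchCoef x y t)).pow 2
  obtain ⟨δ, hδ, hδ'⟩ := Metric.eventually_nhds_iff.1
    (hc.continuousAt.eventually (lt_mem_nhds hw'2))
  have hw'0 : 0 < w' := hw0.trans_lt hw'
  have hsmall : 0 < δ * (w' - w) / (2 * w') := by
    have := sub_pos.2 hw'
    positivity
  refine ⟨δ * (w' - w) / (2 * w'), hsmall, ?_⟩
  intro D C A _ _ _ _ _ S i hi hp hN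
  have hsq := avg_goodFraction_sq_le S hi
  have hav := avg_goodFraction S i
  have hp0 : 0 ≤ (Nat.card S : ℝ) / Nat.card C := by positivity
  generalize (Nat.card S : ℝ) / Nat.card C = p at *
  -- Continuity controls the amplitude only for `r < δ`. The quadratic correction makes the left
  -- side nonpositive beyond `δ`, so two moments of the good fraction suffice.
  have hpt : ∀ r : ℝ, 0 ≤ r → w' * r - w' / δ * r ^ 2 ≤ (searchCoef x y r t).1 ^ 2 * r := by
    intro r hr
    by_cases h : r < δ
    · have h1 : w' < (searchCoef x y r t).1 ^ 2 := hδ' (by rw [Real.dist_0_eq_abs, abs_of_nonneg hr]; exact h)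
      have h2 : 0 ≤ w' / δ * r ^ 2 := by positivity
      nlinarith
    · have h1 : w' * r - w' / δ * r ^ 2 ≤ 0 := by
        have : w' * r - w' / δ * r ^ 2 = w' * r / δ * (δ - r) := by field_simp
        rw [this]
        exact mul_nonpos_of_nonneg_of_nonpos (by positivity) (by linarith)
      exact h1.trans (by positivity)
  refine le_trans ?_ (avg_mono fun H : D → C => hpt _ (goodFraction_nonneg S fun a => H (i a)))
  rw [avg_sub, avg_mul_left, avg_mul_left, hav]
  -- Having at least `1 / p` messages bounds the diagonal term by `p ^ 2`.
  have h1 : avg (fun H : D → C => (goodFraction S fun a => H (i a)) ^ 2) ≤ 2 * p * p := by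
    rw [div_eq_mul_one_div p] at hsq
    nlinarith
  have h2 : w' / δ * avg (fun H : D → C => (goodFraction S fun a => H (i a)) ^ 2)
      ≤ w' / δ * (2 * p * p) := mul_le_mul_of_nonneg_left h1 (by positivity)
  have h3 : w' / δ * (2 * p * p) ≤ (w' - w) * p := by
    rw [le_div_iff₀ (by positivity)] at hp
    have : w' / δ * (2 * p * p) = p * (2 * w') * p / δ := by ring
    rw [this, div_le_iff₀ hδ]
    nlinarith
  linarith

/-- At density `0` the mean is the clean amplitude of bad messages. That amplitude survives the
reflection and alternates between `x` and `y`, while the good amplitude `g` becomes `2 * mean - g`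
and grows linearly. -/
theorem searchCoef_zero (x y : ℝ) (t : ℕ) :
    searchCoef x y 0 (2 * t) = ((2 * t + 1) * (x - y) , x, y) ∧
      searchCoef x y 0 (2 * t + 1) = ((2 * t + 3) * y - (2 * t + 1) * x, y, x) := by
  induction t with
  | zero => constructor <;> ext <;> simp [searchCoef] <;> ring
  | succ t ih =>
    have h1 : searchCoef x y 0 (2 * (t + 1)) = ((2 * (t + 1 : ℕ) + 1) * (x - y), x, y) := by
      rw [show 2 * (t + 1) = 2 * t + 1 + 1 by ring, searchCoef, ih.2]
      ext <;> push_cast <;> ring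
    refine ⟨h1, ?_⟩
    rw [searchCoef, h1]
    ext <;> push_cast <;> ring

/-- For every `s ≥ 3` a search with `s - 1` queries boosts the success probability by more than
`11 / 10 * s ^ 2`. -/
theorem exists_searchCoef_gt (s : ℕ) (hs : 3 ≤ s) :
    ∃ x y : ℝ, x ^ 2 + y ^ 2 = 1 ∧ 11 / 10 * (s : ℝ) ^ 2 < (searchCoef x y 0 (s - 2)).1 ^ 2 := by
  obtain ⟨t, ht | ht⟩ := Nat.even_or_odd' s
  · obtain ⟨u, rfl⟩ : ∃ u, t = u + 2 := ⟨t - 2, by omega⟩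
    -- A rational approximation of the optimum `(-1, 1) / √2`, whose value is `2 * (s - 1) ^ 2`. The
    -- tightest case is `s = 4`, with `18` against `17.6`.
    refine ⟨-(20 / 29), 21 / 29, by norm_num, ?_⟩
    have : s - 2 = 2 * (u + 1) := by omega
    rw [this, (searchCoef_zero _ _ _).1, ht]
    push_cast
    nlinarith [(Nat.cast_nonneg u : (0 : ℝ) ≤ u)]
  · obtain ⟨u, rfl⟩ : ∃ u, t = u + 1 := ⟨t - 1, by omega⟩
    -- For odd `s` the optimum is `s ^ 2 + (s - 2) ^ 2`. The tightest case is `s = 3`, with `10`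
    -- against `9.9`; there the optimal vector is `(-1, 3) / √10`, close to this one.
    refine ⟨-(7 / 25), 24 / 25, by norm_num, ?_⟩
    have : s - 2 = 2 * u + 1 := by omega
    rw [this, (searchCoef_zero _ _ _).2, ht]
    push_cast
    nlinarith [(Nat.cast_nonneg u : (0 : ℝ) ≤ u)]

/-! ### Distributing the queries over the rounds. -/

theorem exp_sq_le {v : ℝ} (h1 : -(1 / 7) ≤ v) (h2 : v ≤ 1 / 7) :
    Real.exp v ^ 2 ≤ 11 / 10 * (1 + v) ^ 2 := by
  have h3 : Real.exp v * (1 - v) ≤ 1 := by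
    have := Real.add_one_le_exp (-v)
    calc Real.exp v * (1 - v) ≤ Real.exp v * Real.exp (-v) := by gcongr; linarith
      _ = 1 := by rw [← Real.exp_add, add_neg_cancel, Real.exp_zero]
  have h4 : (Real.exp v * (1 - v)) ^ 2 ≤ 1 :=
    pow_le_one₀ (mul_nonneg (Real.exp_pos v).le (by linarith)) h3
  have h5 : (1 : ℝ) ≤ 11 / 10 * (1 + v) ^ 2 * (1 - v) ^ 2 := by
    have h6 : v ^ 2 ≤ 1 / 49 := by nlinarith
    have h7 : (48 / 49 : ℝ) ^ 2 ≤ (1 - v ^ 2) ^ 2 := by gcongr; linarith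
    nlinarith
  have h8 : 0 < (1 - v) ^ 2 := by
    have : 0 < 1 - v := by linarith
    positivity
  refine le_of_mul_le_mul_right ?_ h8
  calc _ = (Real.exp v * (1 - v)) ^ 2 := by ring
    _ ≤ _ := h4.trans h5

/-- For fixed `q`, the maximum of `(q / n) ^ (2 * n)` over real `n > 0` is `exp (2 / e) ^ q`. The
bound is chosen so that `2.11 ^ 3 ≤ 11 / 10 * 3 ^ 2`. -/
theorem exp_two_div_exp_one_le : Real.exp (2 / Real.exp 1) ≤ 2.11 := by
  have h1 : 2 / Real.exp 1 ≤ 0.73577 := by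
    rw [div_le_iff₀ (Real.exp_pos 1)]
    nlinarith [Real.exp_one_gt_d9]
  have h2 := Real.log_two_gt_d9
  have h3 : Real.exp 0.043 * (1 - 0.043) ≤ 1 := by
    have := Real.add_one_le_exp (-0.043)
    calc Real.exp 0.043 * (1 - 0.043) ≤ Real.exp 0.043 * Real.exp (-0.043) := by
          gcongr; linarith
      _ = 1 := by rw [← Real.exp_add, add_neg_cancel, Real.exp_zero]
  calc Real.exp (2 / Real.exp 1) ≤ Real.exp (Real.log 2 + 0.043) :=
        Real.exp_le_exp.2 (by linarith)
    _ = 2 * Real.exp 0.043 := by rw [Real.exp_add, Real.exp_log two_pos]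
    _ ≤ 2.11 := by linarith

/-- A distribution of `q` queries to at most `n` rounds whose product of squares, up to constant
factors, beats `(q / n) ^ (2 * n)`. -/
theorem exists_schedule {n q : ℕ} (hn : 1 ≤ n) (hq : n < q) :
    ∃ L : List ℕ, (∀ s ∈ L, 3 ≤ s) ∧ L.length ≤ n ∧ L.sum ≤ q + 1 ∧
      ((q : ℝ) / n) ^ (2 * n) ≤ (L.map fun s : ℕ => 11 / 10 * (s : ℝ) ^ 2).prod := by
  have hn0 : (0 : ℝ) < n := by exact_mod_cast hn
  rcases le_or_gt (3 * n) q with h3 | h3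
  · have hdm := Nat.div_add_mod q n
    have hd := Nat.mod_lt q hn
    have hm : 3 ≤ q / n := (Nat.le_div_iff_mul_le hn).2 h3
    generalize q / n = m at *
    generalize q % n = d at *
    -- An even distribution with sum exactly `q`.
    refine ⟨List.replicate (n - d) m ++ List.replicate d (m + 1), ?_, ?_, ?_, ?_⟩
    · intro s hs
      simp only [List.mem_append, List.mem_replicate] at hs
      omega
    · simp only [List.length_append, List.length_replicate]; omega
    · obtain ⟨u, rfl⟩ : ∃ u, n = u + d := ⟨n - d, by omega⟩
      simp only [List.sum_append, List.sum_replicate, smul_eq_mul, Nat.add_sub_cancel]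
      nlinarith
    · have hm' : (3 : ℝ) ≤ m := by exact_mod_cast hm
      obtain ⟨u, hu⟩ : ∃ u, n = u + d := ⟨n - d, by omega⟩
      have hud : n - d = u := by omega
      -- From `t ≤ exp (t - 1)`, `q / n` is at most `r₀` times an exponential whose exponent is
      -- affine in `q / n`, so its `2 * n`-th power splits over the rounds. Centring at the midpoint
      -- keeps both `s / r₀ - 1` within `1 / 7`, as `m ≥ 3`.
      set r₀ : ℝ := m + 1 / 2 with hr₀
      have hr : 0 < r₀ := by positivity
      have key : ∀ s : ℝ, (s = m ∨ s = m + 1) →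
          r₀ ^ 2 * Real.exp (s / r₀ - 1) ^ 2 ≤ 11 / 10 * s ^ 2 := by
        intro s hs
        have h1 : -(1 / 7) ≤ s / r₀ - 1 := by
          rw [neg_le_sub_iff_le_add, ← sub_le_iff_le_add, le_div_iff₀ hr]
          rcases hs with rfl | rfl <;> linarith
        have h2 : s / r₀ - 1 ≤ 1 / 7 := by
          rw [sub_le_iff_le_add, div_le_iff₀ hr]
          rcases hs with rfl | rfl <;> linarith
        calc _ ≤ r₀ ^ 2 * (11 / 10 * (1 + (s / r₀ - 1)) ^ 2) := by
              gcongr; exact exp_sq_le h1 h2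
          _ = _ := by field_simp; ring
      simp only [List.map_append, List.map_replicate, List.prod_append, List.prod_replicate, hud]
      have hqr : (q : ℝ) / n ≤ r₀ * Real.exp ((q : ℝ) / n / r₀ - 1) := by
        have := Real.add_one_le_exp ((q : ℝ) / n / r₀ - 1)
        rw [sub_add_cancel, div_le_iff₀ hr] at this
        linarith
      calc ((q : ℝ) / n) ^ (2 * n) ≤ (r₀ * Real.exp ((q : ℝ) / n / r₀ - 1)) ^ (2 * n) := by
            gcongr
        _ = (r₀ ^ 2 * Real.exp (m / r₀ - 1) ^ 2) ^ u
            * (r₀ ^ 2 * Real.exp ((m + 1) / r₀ - 1) ^ 2) ^ d := by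
            simp only [mul_pow, ← pow_mul, ← Real.exp_nat_mul]
            have : ((2 * n : ℕ) : ℝ) * ((q : ℝ) / n / r₀ - 1)
                = ((2 * u : ℕ) : ℝ) * (m / r₀ - 1) + ((2 * d : ℕ) : ℝ) * ((m + 1) / r₀ - 1) := by
              have hq' : (q : ℝ) = n * m + d := by exact_mod_cast hdm.symm
              have hn' : (n : ℝ) = u + d := by exact_mod_cast hu
              rw [hq']
              push_cast
              field_simp
              rw [hn']
              ring
            rw [this, Real.exp_add, show 2 * n = 2 * u + 2 * d by omega, pow_add]
            push_cast
            ring_nf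
        _ ≤ _ := by
            have h1 := key m (Or.inl rfl)
            have h2 := key (m + 1) (Or.inr rfl)
            push_cast
            gcongr
  · obtain ⟨j, ρ, hρ, hj⟩ : ∃ j ρ, ρ < 3 ∧ q = 3 * j + 2 + ρ :=
      ⟨(q - 2) / 3, (q - 2) % 3, Nat.mod_lt _ (by norm_num), by omega⟩
    -- With fewer than three queries per round it is better to attack only some rounds. The sum is
    -- `q + 1`, because no challenge is read after the last search.
    refine ⟨List.replicate j 3 ++ [3 + ρ], ?_, ?_, ?_, ?_⟩
    · intro s hs
      simp only [List.mem_append, List.mem_replicate, List.mem_singleton] at hs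
      omega
    · simp only [List.length_append, List.length_replicate, List.length_singleton]; omega
    · simp only [List.sum_append, List.sum_replicate, smul_eq_mul, List.sum_singleton]; omega
    · have hz := exp_two_div_exp_one_le
      have hz0 := Real.exp_pos (2 / Real.exp 1)
      have he := Real.exp_pos 1
      have h1 : (q : ℝ) / n ≤ Real.exp ((q : ℝ) / n / Real.exp 1) := by
        have := Real.add_one_le_exp ((q : ℝ) / n / Real.exp 1 - 1)
        rw [sub_add_cancel, Real.exp_sub, div_le_div_iff_of_pos_right he] at this
        exact this
      simp only [List.map_append, List.map_replicate, List.prod_append, List.prod_replicate,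
        List.map_singleton, List.prod_singleton]
      calc ((q : ℝ) / n) ^ (2 * n) ≤ Real.exp ((q : ℝ) / n / Real.exp 1) ^ (2 * n) := by gcongr
        _ = Real.exp (2 / Real.exp 1) ^ q := by
            rw [← Real.exp_nat_mul, ← Real.exp_nat_mul]
            congr 1
            push_cast
            field_simp
        _ ≤ 2.11 ^ q := by gcongr
        _ = (2.11 ^ 3) ^ j * 2.11 ^ (2 + ρ) := by rw [hj, ← pow_mul, ← pow_add, add_assoc]
        _ ≤ _ := by
            gcongr ?_ ^ j * ?_
            · norm_num
            · interval_cases ρ <;> norm_num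

/-! ### The protocol and its soundness error. -/

section Protocol

variable {n : ℕ} {A C Z : Type} [Fintype C] [Nonempty C]

open Classical in
theorem PMF.toOuterMeasure_bind_of_forall {α β : Type} (p : PMF α) (f : α → PMF β) (s : Set β)
    (t : Set α) (c : ENNReal) (h : ∀ a, (f a).toOuterMeasure s = if a ∈ t then c else 0) :
    (p.bind f).toOuterMeasure s = p.toOuterMeasure t * c := by
  rw [PMF.toOuterMeasure_bind_apply, PMF.toOuterMeasure_apply, ← ENNReal.tsum_mul_right]
  refine tsum_congr fun a => ?_
  rw [h, Set.indicator_apply]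
  split_ifs <;> simp

theorem PMF.toOuterMeasure_univ {α : Type} (p : PMF α) : p.toOuterMeasure Set.univ = 1 := by
  rw [PMF.toOuterMeasure_apply_eq_one_iff]; exact Set.subset_univ _

/-- Each challenge is drawn independently of the transcript and of the current message, so no prover
strategy changes the probability. -/
theorem Prover.transcript_toOuterMeasure (P : Prover n A C Z) (S : Set C) (k : ℕ) :
    (P.transcript k).toOuterMeasure {t | ∀ i, (t i).2 ∈ S}
      = ((PMF.uniformOfFintype C).toOuterMeasure S) ^ k := by
  classical
  induction k with
  | zero =>
    have : {t : Fin 0 → A × C | ∀ i, (t i).2 ∈ S} = Set.univ := by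
      ext t; simp
    rw [this, PMF.toOuterMeasure_univ, pow_zero]
  | succ k ih =>
    rw [pow_succ, ← ih, Prover.transcript]
    refine PMF.toOuterMeasure_bind_of_forall _ _ _ _ _ fun t => ?_
    rw [PMF.toOuterMeasure_bind_of_forall _ _ _ Set.univ
      (if t ∈ {t : Fin k → A × C | ∀ i, (t i).2 ∈ S} then
        (PMF.uniformOfFintype C).toOuterMeasure S else 0), PMF.toOuterMeasure_univ, one_mul]
    · split_ifs <;> rfl
    intro a
    rw [if_pos (Set.mem_univ a)]
    split_ifs with ht
    · rw [PMF.toOuterMeasure_bind_of_forall _ _ _ S 1, mul_one]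
      intro c
      rw [PMF.toOuterMeasure_pure_apply]
      congr 1
      simp only [Set.mem_ofPred_eq, Fin.forall_fin_succ', Fin.snoc_castSucc, Fin.snoc_last,
        eq_iff_iff]
      exact and_iff_right ht
    · rw [PMF.toOuterMeasure_bind_of_forall _ _ _ ∅ 0, mul_zero]
      intro c
      rw [PMF.toOuterMeasure_pure_apply, ite_self, if_neg]
      simp only [Set.mem_ofPred_eq, Fin.forall_fin_succ', Fin.snoc_castSucc, Fin.snoc_last]
      exact fun h => ht h.1

theorem Prover.acceptProb_forall_mem (P : Prover n A C Z) (S : Set C) :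
    P.acceptProb (fun _ c _ => ∀ i, c i ∈ S) = ((S.ncard : ℝ) / Nat.card C) ^ n := by
  classical
  rw [Prover.acceptProb, Prover.run, PMF.toOuterMeasure_bind_of_forall _ _ _
    {t | ∀ i, (t i).2 ∈ S} 1, mul_one, Prover.transcript_toOuterMeasure, ENNReal.toReal_pow,
    PMF.toOuterMeasure_uniformOfFintype_apply, ENNReal.toReal_div]
  · simp [Set.ncard_eq_toFinset_card', Nat.card_eq_fintype_card]
  · intro t
    rw [PMF.toOuterMeasure_bind_of_forall _ _ _ Set.univ
      (if t ∈ {t : Fin n → A × C | ∀ i, (t i).2 ∈ S} then 1 else 0), PMF.toOuterMeasure_univ,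
      one_mul]
    · split_ifs <;> rfl
    intro z
    rw [if_pos (Set.mem_univ z), PMF.toOuterMeasure_pure_apply]
    by_cases h : ∀ i, (t i).2 ∈ S
    · exact (if_pos h).trans (if_pos h).symm
    · exact (if_neg h).trans (if_neg h).symm

variable [AddCommGroup C]

/-- The protocol for the language `{true}` in which the verifier accepts a proof for `false` iff
all challenges lie in `S`. -/
noncomputable def challengeProtocol (n : ℕ) (A : Type) [Nonempty A] (S : AddSubgroup C) :
    PCIP n Bool A C Unit where
  lang := {true}
  accepts x _ c _ := x = true ∨ ∀ i, c i ∈ S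
  prover _ := ⟨fun _ _ => PMF.pure (Classical.arbitrary A), fun _ => PMF.pure ()⟩
  complete := by
    rintro x rfl
    have : ∀ P : Prover n A C Unit, P.acceptProb (fun _ _ _ => True) = 1 := fun P => by
      simp [Prover.acceptProb, PMF.toOuterMeasure_univ]
    simp only [true_or]
    exact this _

theorem isSoundnessError_challengeProtocol (n : ℕ) (A : Type) [Nonempty A] (S : AddSubgroup C) :
    (challengeProtocol n A S).IsSoundnessError (((Nat.card S : ℝ) / Nat.card C) ^ n) := by
  have key : ∀ P : Prover n A C Unit,
      P.acceptProb ((challengeProtocol n A S).accepts false)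
        = ((Nat.card S : ℝ) / Nat.card C) ^ n := fun P => by
    have := P.acceptProb_forall_mem (S : Set C)
    rw [← Nat.card_coe_set_eq (S : Set C)] at this
    simpa [challengeProtocol] using this
  have : {p : ℝ | ∃ x, x ∉ (challengeProtocol n A S).lang ∧ ∃ P : Prover n A C Unit,
      p = P.acceptProb ((challengeProtocol n A S).accepts x)}
      = {((Nat.card S : ℝ) / Nat.card C) ^ n} := by
    ext p
    constructor
    · rintro ⟨x, hx, P, rfl⟩
      cases x with
      | false => exact key P
      | true => exact absurd rfl hx
    · rintro rfl
      exact ⟨false, Bool.false_ne_true, (challengeProtocol n A S).prover false, (key _).symm⟩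
  unfold PCIP.IsSoundnessError
  rw [this]
  exact isLUB_singleton

end Protocol

/-- The bit strings of length `m + r` whose first `m` bits vanish. -/
def zeroPrefix (m r : ℕ) : AddSubgroup (BitString (m + r)) where
  carrier := {c | ∀ i : Fin m, c (Fin.castAdd r i) = 0}
  zero_mem' _ := rfl
  add_mem' ha hb i := by simp [ha i, hb i]
  neg_mem' ha i := by simp [ha i]

theorem card_zeroPrefix (m r : ℕ) : Nat.card (zeroPrefix m r) = 2 ^ r := by
  have e : zeroPrefix m r ≃ (Fin r → ZMod 2) :=
    { toFun := fun c j => c.1 (Fin.natAdd m j)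
      invFun := fun c => ⟨Fin.append 0 c, fun i => by simp⟩
      left_inv := fun c => by
        ext j
        refine Fin.addCases (fun i => ?_) (fun i => ?_) j
        · simpa using (c.2 i).symm
        · simp
      right_inv := fun c => by funext j; simp }
  rw [Nat.card_congr e, Nat.card_eq_fintype_card]
  simp [ZMod.card]

theorem card_bitString (ℓ : ℕ) : Fintype.card (BitString ℓ) = 2 ^ ℓ := by
  simp [BitString, ZMod.card]

theorem BitString.add_self {ℓ : ℕ} (c : BitString ℓ) : c + c = 0 := by
  funext i; exact CharTwo.add_self_eq_zero (c i)

/-! ### The multi-round attack. -/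

section Attack

variable {n : ℕ} {X A C : Type}

/-- The challenges of the rounds from `i` on, computed by the hash chain that enters round `i` with
the value `u` and uses the messages `b`, all lie in `S`. -/
def GoodFrom (S : Set C) (H : HashInput n X A C → C) :
    (r i : ℕ) → i + r = n → X ⊕ C → (Fin r → A) → Prop
  | 0, _, _, _, _ => True
  | r + 1, i, h, u, b => H (⟨i, by omega⟩, u, b 0) ∈ S ∧
      GoodFrom S H r (i + 1) (by omega) (Sum.inr (H (⟨i, by omega⟩, u, b 0))) (Fin.tail b)

theorem GoodFrom.hashChain_mem {S : Set C} {H : HashInput n X A C → C} {x : X} {a : Fin n → A}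
    (r i : ℕ) (h : i + r = n) (u : X ⊕ C) (b : Fin r → A)
    (hb : ∀ j : Fin r, b j = a ⟨i + j, by omega⟩)
    (hu : ∀ hi : i < n, H (⟨i, hi⟩, u, a ⟨i, hi⟩) = hashChain H x a i hi)
    (hg : GoodFrom S H r i h u b) (k : ℕ) (hk : k < n) (hik : i ≤ k) :
    hashChain H x a k hk ∈ S := by
  induction r generalizing i u with
  | zero => omega
  | succ r ih =>
    have hi : i < n := by omega
    have h0 : b 0 = a ⟨i, hi⟩ := hb 0
    obtain ⟨h1, h2⟩ := hg
    rw [h0, hu hi] at h1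
    rw [h0, hu hi] at h2
    rcases hik.eq_or_lt with rfl | hlt
    · exact h1
    · refine ih (i + 1) _ _ _ (fun j => ?_) (fun hi' => rfl) h2 hlt
      rw [Fin.tail, hb]
      congr 2
      simp only [Fin.val_succ]
      omega

theorem goodFrom_congr {S : Set C} {H H' : HashInput n X A C → C} (r i : ℕ) (h : i + r = n)
    (u : X ⊕ C) (b : Fin r → A) (hH : ∀ d : HashInput n X A C, i ≤ d.1 → H d = H' d) :
    GoodFrom S H r i h u b ↔ GoodFrom S H' r i h u b := by
  induction r generalizing i u with
  | zero => exact Iff.rfl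
  | succ r ih =>
    rw [GoodFrom, GoodFrom, hH _ le_rfl]
    exact and_congr_right fun _ => ih _ _ _ _ fun d hd => hH d (Nat.le_of_succ_le hd)

variable [Fintype X] [Fintype A] [Fintype C] [AddCommGroup C]

open Classical in
theorem avg_goodFrom (S : AddSubgroup C) (r i : ℕ) (h : i + r = n) (u : X ⊕ C) (b : Fin r → A) :
    avg (fun H : HashInput n X A C → C => if GoodFrom (S : Set C) H r i h u b then (1 : ℝ) else 0)
      = ((Nat.card S : ℝ) / Nat.card C) ^ r := by
  induction r generalizing i u with
  | zero => simp [GoodFrom, avg_const]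
  | succ r ih =>
    have hi : i < n := by omega
    set d : HashInput n X A C := (⟨i, hi⟩, u, b 0) with hd
    have h1 : ∀ H : HashInput n X A C → C,
        (if GoodFrom (S : Set C) H (r + 1) i h u b then (1 : ℝ) else 0)
        = (if H d ∈ S then (1 : ℝ) else 0) *
          if GoodFrom (S : Set C) H r (i + 1) (by omega) (Sum.inr (H d)) (Fin.tail b)
            then (1 : ℝ) else 0 := by
      intro H
      rw [ite_zero_mul_ite_zero, one_mul]
      exact if_congr Iff.rfl rfl rfl
    simp only [h1]
    rw [avg_eq_avg_avg (fun e => e.1.1 ≤ i) fun H H' => (if H d ∈ S then (1 : ℝ) else 0) *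
      if GoodFrom (S : Set C) H' r (i + 1) (by omega) (Sum.inr (H d)) (Fin.tail b)
        then (1 : ℝ) else 0]
    · simp only [avg_mul_left, ih, avg_mul_right, avg_mem]
      ring
    · intro H K H' K' h2 h3
      rw [h2 d le_rfl]
      congr 1
      exact if_congr (goodFrom_congr _ _ _ _ _ fun e he => h3 e (by omega)) rfl rfl

-- The search and the challenge it leads to depend only on hash inputs of rounds up to `i`, the
-- continuation only on later ones. By independence the continuation averages to at least `B`,
-- whichever challenge was found.
open Classical in
theorem le_avg_search_bind [Nonempty A] (S : AddSubgroup C) (i : Fin n) (u : X ⊕ C) (g : ℝ → ℝ)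
    (hg : ∀ z, 0 ≤ g z) (v : C → (HashInput n X A C → C) → ℝ)
    (hv : ∀ c H H', (∀ d : HashInput n X A C, i.1 + 1 ≤ d.1 → H d = H' d) → v c H = v c H')
    {B : ℝ} (hB : ∀ c, B ≤ avg (v c)) :
    (avg fun H : HashInput n X A C → C => g (goodFraction S fun a => H (i, u, a))
        * goodFraction S fun a => H (i, u, a)) * B
      ≤ avg fun H => ∑ a, (if H (i, u, a) ∈ S then
          g (goodFraction S fun a => H (i, u, a)) / Fintype.card A else 0)
          * (if H (i, u, a) ∈ S then v (H (i, u, a)) H else 0) := by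
  have hN : (Fintype.card A : ℝ) ≠ 0 := by exact_mod_cast Fintype.card_ne_zero
  rw [avg_eq_avg_avg (fun e => e.1 ≤ i) fun H H' => ∑ a, (if H (i, u, a) ∈ S then
          g (goodFraction S fun a => H (i, u, a)) / Fintype.card A else 0)
          * (if H (i, u, a) ∈ S then v (H (i, u, a)) H' else 0)]
  · rw [← avg_mul_right]
    refine avg_mono fun H => ?_
    rw [avg_sum]
    simp only [avg_mul_left]
    have h1 : g (goodFraction S fun a => H (i, u, a)) * (goodFraction S fun a => H (i, u, a)) * B
        = ∑ a, (if H (i, u, a) ∈ S then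
          g (goodFraction S fun a => H (i, u, a)) / Fintype.card A else 0) * B := by
      rw [← Finset.sum_mul, sum_ite_goodFraction]
      field_simp
      ring
    rw [h1]
    refine Finset.sum_le_sum fun a _ => ?_
    split_ifs with ha
    · exact mul_le_mul_of_nonneg_left (hB _) (div_nonneg (hg _) (Nat.cast_nonneg _))
    · simp
  · intro H K H' K' h2 h3
    have h4 : ∀ a, H (i, u, a) = K (i, u, a) := fun a => h2 _ le_rfl
    simp only [h4]
    refine Finset.sum_congr rfl fun a _ => ?_
    rw [hv _ H' K' fun d hd => h3 d (by rw [Fin.le_def]; omega)]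

open Classical in
/-- The multi-round attack: in the rounds covered by `L` it searches for a message with a good
challenge, with `s - 1` queries for the entry `s`, and it guesses the remaining messages. -/
theorem exists_attack [Nonempty A] [Nonempty (HashInput n X A C)] (hC : ∀ c : C, c + c = 0) (S : AddSubgroup C) (w : ℕ → ℝ)
    (hw : ∀ s, 0 ≤ w s) (r : ℕ) (L : List ℕ) (hlen : L.length ≤ r) (hL3 : ∀ s ∈ L, 2 ≤ s)
    (hL : ∀ s ∈ L, ∃ x y : ℝ, x ^ 2 + y ^ 2 = 1 ∧ ∀ e : A → HashInput n X A C,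
      Function.Injective e → w s * ((Nat.card S : ℝ) / Nat.card C) ≤
        avg fun H : HashInput n X A C → C =>
          (searchCoef x y (goodFraction S fun a => H (e a)) (s - 2)).1 ^ 2
            * goodFraction S fun a => H (e a))
    (i : ℕ) (h : i + r = n) (u : X ⊕ C) :
    ∃ v : (HashInput n X A C → C) → ℝ,
      Achieves (L.sum - 1) (fun H b => GoodFrom (S : Set C) H r i h u b) v ∧
      (∀ H H', (∀ d : HashInput n X A C, i ≤ d.1 → H d = H' d) → v H = v H') ∧
      (L.map w).prod * ((Nat.card S : ℝ) / Nat.card C) ^ r ≤ avg v := by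
  set p : ℝ := (Nat.card S : ℝ) / Nat.card C with hp
  have hguess : ∀ (r i : ℕ) (h : i + r = n) (u : X ⊕ C) (b : Fin r → A)
      (H H' : HashInput n X A C → C), (∀ d : HashInput n X A C, i ≤ d.1 → H d = H' d) →
      (if GoodFrom (S : Set C) H r i h u b then (1 : ℝ) else 0)
        = if GoodFrom (S : Set C) H' r i h u b then (1 : ℝ) else 0 :=
    fun r i h u b H H' hH => if_congr (goodFrom_congr _ _ _ _ _ hH) rfl rfl
  have b₀ : ∀ r, Fin r → A := fun r _ => Classical.arbitrary A
  induction r generalizing L i u with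
  | zero =>
    obtain rfl : L = [] := List.length_eq_zero_iff.1 (Nat.le_zero.1 hlen)
    exact ⟨_, Achieves.const 0 _ (b₀ 0), hguess _ _ _ _ _, by
      simpa only [List.map_nil, List.prod_nil, one_mul] using (avg_goodFrom S _ _ h u _).ge⟩
  | succ r ih =>
    have hi : i < n := by omega
    cases L with
    | nil =>
      exact ⟨_, Achieves.const 0 _ (b₀ (r + 1)), hguess _ _ _ _ _, by
        simpa only [List.map_nil, List.prod_nil, one_mul] using (avg_goodFrom S _ _ h u _).ge⟩
    | cons s L =>
      obtain ⟨x, y, hxy, hs⟩ := hL s (by simp)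
      have hs2 := hL3 s (by simp)
      -- Here `q` counts the queries after the search of this round, including the one that reads
      -- its challenge.
      have htail : ∃ (q : ℕ) (v : C → (HashInput n X A C → C) → ℝ),
          s - 1 + q = (s :: L).sum - 1 ∧
          (∀ a, Achieves q (fun H b => GoodFrom (S : Set C) H r (i + 1) (by omega)
            (Sum.inr (H (⟨i, hi⟩, u, a))) b) fun H => v (H (⟨i, hi⟩, u, a)) H) ∧
          (∀ c H H', (∀ d : HashInput n X A C, i + 1 ≤ d.1 → H d = H' d) → v c H = v c H') ∧
          ∀ c, (L.map w).prod * p ^ r ≤ avg (v c) := by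
        cases L with
        | nil =>
          -- Guessed messages do not depend on the challenge, so it need not be read; this saves the
          -- query behind `L.sum - 1`.
          exact ⟨0, fun c H => if GoodFrom (S : Set C) H r (i + 1) (by omega) (Sum.inr c) (b₀ r)
            then 1 else 0, by simp, fun a => Achieves.const 0 _ (b₀ r),
            fun c => hguess _ _ _ _ _, fun c => by
              simpa only [List.map_nil, List.prod_nil, one_mul] using
                (avg_goodFrom S r (i + 1) (by omega) (Sum.inr c) (b₀ r)).ge⟩
        | cons s' L =>
          choose v hv hloc hav using fun c : C => ih (s' :: L) (by simpa using hlen)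
            (fun t ht => hL3 t (List.mem_cons_of_mem _ ht))
            (i + 1) (by omega) (Sum.inr c) fun t ht => hL t (List.mem_cons_of_mem _ ht)
          have hs2' := hL3 s' (by simp)
          refine ⟨1 + ((s' :: L).sum - 1), v, by simp only [List.sum_cons]; omega, fun a => ?_,
            hloc, hav⟩
          have h1 := (samples_oracle_value (C := C)
            ((⟨i, hi⟩, u, a) : HashInput n X A C)).bind (fun H c => by split_ifs <;> norm_num)
            (fun _ b => b) (G := fun H b => GoodFrom (S : Set C) H r (i + 1) (by omega)
            (Sum.inr (H (⟨i, hi⟩, u, a))) b)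
            (v := fun c H => if H (⟨i, hi⟩, u, a) = c then v c H else 0)
            -- The continuation prepared for `c` is credited only when `c` is the actual challenge.
            (fun c => (hv c).mono fun H => by
              by_cases hc : H (⟨i, hi⟩, u, a) = c
              · right
                subst hc
                simp
              · left; simp [hc])
          simpa using h1
      obtain ⟨q, v, hq, hv, hloc, hav⟩ := htail
      obtain ⟨t, rfl⟩ : ∃ t, s = t + 2 := ⟨s - 2, by omega⟩
      have hsearch := (samples_search hC (⟨i, hi⟩ : Fin n) u S hxy t).bind
        (fun H a => by split_ifs <;> positivity)
        (fun a (b : Fin r → A) => (Fin.cons a b : Fin (r + 1) → A))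
        (G := fun H b => GoodFrom (S : Set C) H (r + 1) i h u b)
        (v := fun a H => if H (⟨i, hi⟩, u, a) ∈ S then v (H (⟨i, hi⟩, u, a)) H else 0)
        (fun a => (hv a).mono fun H => by
          by_cases hc : H (⟨i, hi⟩, u, a) ∈ S
          · right
            refine ⟨by simp [hc], fun b hb => ?_⟩
            rw [GoodFrom]
            simp only [Fin.cons_zero, Fin.tail_cons]
            exact ⟨hc, hb⟩
          · left; simp [hc])
      refine ⟨_, hq ▸ hsearch, fun H H' hH => ?_, ?_⟩
      · have h1 : ∀ a, H (⟨i, hi⟩, u, a) = H' (⟨i, hi⟩, u, a) := fun a => hH _ le_rfl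
        simp only [h1]
        refine Finset.sum_congr rfl fun a _ => ?_
        rw [hloc _ H H' fun d hd => hH d (by omega)]
      · refine le_trans ?_ (le_avg_search_bind S ⟨i, hi⟩ u
          (fun z => (searchCoef x y z t).1 ^ 2) (fun z => sq_nonneg _) v hloc hav)
        have h1 := hs (fun a => (⟨i, hi⟩, u, a)) fun a a' haa => by simpa using haa
        have h2 : 0 ≤ (L.map w).prod * p ^ r :=
          mul_nonneg (List.prod_nonneg (by simpa using fun a _ => hw a)) (by positivity)
        calc _ = w (t + 2) * p * ((L.map w).prod * p ^ r) := by
              simp only [List.map_cons, List.prod_cons]; ring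
          _ ≤ _ := mul_le_mul_of_nonneg_right h1 h2

open Classical in
theorem exists_adversary [Nonempty A] {q : ℕ} (S : AddSubgroup C)
    {v : (HashInput n Bool A C → C) → ℝ}
    (h : Achieves q (fun H b => GoodFrom (S : Set C) H n 0 (zero_add n) (Sum.inl false) b) v) :
    ∃ 𝒜 : FSAdversary q n Bool A C Unit, avg v ≤ (challengeProtocol n A S).fsSuccess 𝒜 := by
  obtain ⟨W, _, ψ, out, hψ, hvψ⟩ := h
  obtain ⟨𝒜, h𝒜⟩ := hψ.exists_algorithm fun s => (false, out s, ())
  refine ⟨𝒜, ?_⟩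
  have havg : (challengeProtocol n A S).fsSuccess 𝒜 = avg fun H => 𝒜.prob H fun o =>
      o.1 ∉ (challengeProtocol n A S).lang ∧
        (challengeProtocol n A S).fsAccepts H o.1 o.2.1 o.2.2 := by
    unfold avg PCIP.fsSuccess
    congr!
  rw [havg]
  refine avg_mono fun H => ?_
  rw [h𝒜]
  refine (hvψ H).trans (Finset.sum_le_sum fun s _ => ?_)
  split_ifs with h2 h3
  · exact (sq _).ge
  · refine absurd ⟨Bool.false_ne_true, Or.inr fun i => ?_⟩ h3
    exact h2.hashChain_mem n 0 _ _ _ (fun j => by simp) (fun hi => rfl) i.1 i.2 (Nat.zero_le _)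
  · exact sq_nonneg _
  · exact le_rfl

end Attack

/-! ### Choice of parameters and conclusion. -/

theorem exists_query_distribution (n q : ℕ) (hn : 1 ≤ n) :
    ∃ L : List ℕ, (∀ s ∈ L, 3 ≤ s) ∧ L.length ≤ n ∧ L.sum ≤ q + 1 ∧
      ((q : ℝ) / n) ^ (2 * n) ≤ (L.map fun s : ℕ => 11 / 10 * (s : ℝ) ^ 2).prod := by
  rcases le_or_gt q n with h | h
  · have hn0 : (0 : ℝ) < n := by exact_mod_cast hn
    refine ⟨[], by simp, by simp, by simp, ?_⟩
    rw [List.map_nil, List.prod_nil]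
    exact pow_le_one₀ (by positivity) ((div_le_one hn0).2 (by exact_mod_cast h))
  · exact exists_schedule hn h

theorem theorem5 (n : ℕ) (hn : 1 ≤ n) (Q : ℕ) :
    ∃ (ℓ : ℕ) (X A Z : Type) (_ : Fintype X) (_ : Fintype A)
      (Pi : PCIP n X A (BitString ℓ) Z) (ε : ℝ),
      0 < ε ∧ Pi.IsSoundnessError ε ∧
      1 / ε ≤ (Fintype.card (BitString ℓ) : ℝ) ∧
      ∀ q ≤ Q, ∃ 𝒜 : FSAdversary q n X A (BitString ℓ) Z,
        ((n : ℝ) ^ (2 * n))⁻¹ * (q : ℝ) ^ (2 * n) * ε ≤ Pi.fsSuccess 𝒜 := by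
  classical
  have hbound : ∀ s : ℕ, 3 ≤ s → ∃ p₀ : ℝ, 0 < p₀ ∧ ∃ x y : ℝ, x ^ 2 + y ^ 2 = 1 ∧
      ∀ (D C A : Type) [Fintype D] [Fintype C] [AddCommGroup C] [Fintype A]
      [Nonempty A] (S : AddSubgroup C) (i : A → D), Function.Injective i →
      ((Nat.card S : ℝ) / Nat.card C) ≤ p₀ →
      1 / (Fintype.card A : ℝ) ≤ (Nat.card S : ℝ) / Nat.card C →
      11 / 10 * (s : ℝ) ^ 2 * ((Nat.card S : ℝ) / Nat.card C) ≤ avg fun H : D → C =>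
        (searchCoef x y (goodFraction S fun a => H (i a)) (s - 2)).1 ^ 2
          * goodFraction S fun a => H (i a) := by
    intro s hs
    obtain ⟨x, y, hxy, hlt⟩ := exists_searchCoef_gt s hs
    obtain ⟨p₀, h0, h⟩ := exists_density_bound (by positivity) hlt
    exact ⟨p₀, h0, x, y, hxy, h⟩
  choose! p₀ hp₀ x y hxy hsearch using hbound
  -- Only `s ≤ Q + 1` can occur in a list with sum at most `q + 1`, so a single density serves all
  -- `q ≤ Q`.
  have hev : ∀ᶠ m : ℕ in Filter.atTop, ∀ s ∈ Finset.Icc 3 (Q + 1), (1 / 2 : ℝ) ^ m ≤ p₀ s := by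
    rw [Filter.eventually_all_finset]
    intro s hs
    exact (tendsto_pow_atTop_nhds_zero_of_lt_one (by norm_num) (by norm_num)).eventually_le_const
      (hp₀ s (Finset.mem_Icc.1 hs).1)
  obtain ⟨m, hm⟩ := hev.exists
  -- The `m * (n - 1)` free bits leave the density at `2⁻ᵐ` and give `2 ^ (m * n) = 1 / ε`
  -- challenges.
  set S := zeroPrefix m (m * (n - 1)) with hS
  have hcard : Fintype.card (BitString (m + m * (n - 1))) = 2 ^ (m * n) := by
    rw [card_bitString]
    congr 1
    obtain ⟨k, rfl⟩ : ∃ k, n = k + 1 := ⟨n - 1, by omega⟩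
    simp; ring
  have hp : (Nat.card S : ℝ) / Nat.card (BitString (m + m * (n - 1))) = (1 / 2) ^ m := by
    rw [hS, card_zeroPrefix, Nat.card_eq_fintype_card, card_bitString]
    push_cast
    rw [pow_add, one_div, inv_pow]
    field_simp
  have hne' : Nonempty (Fin n) := ⟨⟨0, hn⟩⟩
  have hne : Nonempty (Fin (2 ^ m)) := ⟨⟨0, by positivity⟩⟩
  refine ⟨m + m * (n - 1), Bool, Fin (2 ^ m), Unit, inferInstance, inferInstance,
    challengeProtocol n (Fin (2 ^ m)) S, _, ?_,
    isSoundnessError_challengeProtocol n (Fin (2 ^ m)) S, ?_, ?_⟩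
  · rw [hp]; positivity
  · rw [hp, hcard, ← pow_mul, one_div, one_div, inv_pow, inv_inv]
    push_cast
    exact le_rfl
  · intro q hq
    obtain ⟨L, hL3, hlen, hsum, hprod⟩ := exists_query_distribution n q hn
    obtain ⟨v, hv, -, hav⟩ := exists_attack (n := n) (X := Bool) (A := Fin (2 ^ m))
      BitString.add_self S (fun s => 11 / 10 * (s : ℝ) ^ 2) (fun s => by positivity) n L hlen
      (fun s hs => (Nat.le_succ 2).trans (hL3 s hs))
      (fun s hs => ⟨x s, y s, hxy s (hL3 s hs), fun e he => hsearch s (hL3 s hs) _ _ _ S e he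
        (by rw [hp]; exact hm s (Finset.mem_Icc.2 ⟨hL3 s hs, by
          have := List.le_sum_of_mem hs; omega⟩))
        (by rw [hp]; simp)⟩)
      0 (zero_add n) (Sum.inl false)
    -- The remaining queries are spent idly to reach exactly `q`.
    have hv' := hv.add_queries (q - (L.sum - 1))
    rw [Nat.sub_add_cancel (by omega)] at hv'
    obtain ⟨𝒜, h𝒜⟩ := exists_adversary S hv'
    refine ⟨𝒜, le_trans ?_ (hav.trans h𝒜)⟩
    have h2 : ((n : ℝ) ^ (2 * n))⁻¹ * (q : ℝ) ^ (2 * n) = ((q : ℝ) / n) ^ (2 * n) := by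
      rw [div_pow]; ring
    rw [h2]
    exact mul_le_mul_of_nonneg_right hprod (by positivity)
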